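/- **Setting.** Define the value functions $v_k:[0,1]\to\mathbb R$ by $v_0\equiv 0$ and $$v_k(y)=y\,v_{k-1}(y)+\int_y^1\max\{v_{k-1}(y),\,1+v_{k-1}(1-x)\}\,dx ,\qquad k\ge 1,$$ the optimal threshold functions $g_k(y)=\inf\{x\in[y,1]: v_{k-1}(y)\le 1+v_{k-1}(1-x)\}$, $k\ge 1$, $y\in[0,1]$, and their minimal fixed points $\xi_k=\inf\{y\in[0,1]: g_k(y)=y\}$. For a sequence $X=(X_1,X_2,\dots)$ and $m\le n$ let $$A^o_m(\pi^*_n)=\sum_{i=1}^m \mathbf 1\big(X_i\ge g_{n-i+1}(Y_{i-1})\big),$$ where $Y_0=0$ and $Y_i=1-X_i$ if $X_i\ge g_{n-i+1}(Y_{i-1})$, $Y_i=Y_{i-1}$ otherwise. With $\xi=\lim_{k\to\infty}\xi_k$, for all $m$ let $$A^o_m(\pi_\infty)=\sum_{i=1}^m \mathbf 1\big(X_i\ge \xi\vee Y'_{i-1}\big),$$ where $Y'_0=0$ and $Y'_i=1-X_i$ if $X_i\ge \xi\vee Y'_{i-1}$, $Y'_i=Y'_{i-1}$ otherwise. If the $X_i$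 are independent and uniformly distributed on $[0,1]$, set, for $n\ge 3$, $$\Delta_n=A^o_{n-2}(\pi^*_n)-\mathbb E[A^o_{n-2}(\pi^*_n)]-A^o_{n-2}(\pi_\infty)+\mathbb E[A^o_{n-2}(\pi_\infty)].$$ Given independent random variables $U_1,U_2,\dots$ that are uniformly distributed on $[0,1]$, a feasible policy for horizon $n$ is a sequence $\theta_1<\theta_2<\cdots$ of stopping times with respect to $\mathcal F_i=\sigma\{U_1,\dots,U_i\}$, with values in $\{1,\dots,n\}\cup\{\infty\}$ (strictly increasing as long as they are finite, and equal to $\infty$ from the first infinite value on), such that the selected values alternate, $U_{\theta_1}<U_{\theta_2}>U_{\theta_3}<\cdots$. It is optimal if it maximizes, among all feasible policies for horizon $n$, the expectation of the number of $j$ with $\theta_j\le n$. **Lemma ($L^2$-estimate).** 1. The limit $\xi=\lim_{k\to\infty}\xi_k$ exists. 2. The sum $A^o_m(\pi^*_n)$ represents the number of selections made by the optimal policy: for all independent uniform $U_1,U_2,\dots$ on $[0,1]$ and every $n\ge 0$ an optimal policy for horizon $n$ exists, and for every optimal policy $\theta$ for horizon $n$ there are independent random variables $X_1,X_2,\dots$,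 uniformly distributed on $[0,1]$, with $X_i\in\{U_i,1-U_i\}$ for all $i$, such that almost surely, for all $m\le n$, the number of $j$ with $\theta_j\le m$ equals $A^o_m(\pi^*_n)$ computed from $X$. 3. There is an absolute constant $C$ such that, for every sequence $X_1,X_2,\dots$ of independent random variables uniformly distributed on $[0,1]$ and all $n\ge 3$, the random variable $\Delta_n$ is square integrable and $$\|\Delta_n\|_2^2\le C\sum_{k=3}^n(\xi-\xi_k).$$ In particular, $\|\Delta_n\|_2=o(\sqrt n)$ as $n\to\infty$. -/

import Mathlib

open MeasureTheory ProbabilityTheory Filter Topology Asymptotics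

noncomputable section

namespace AltSelection

/-! ### The reduced dynamic program -/

/-- The value functions `v_k` on `[0,1]`, given by the reduced Bellman recursion
`v_0 = 0`, `v_k(y) = y v_{k-1}(y) + ∫_y^1 max {v_{k-1}(y), 1 + v_{k-1}(1-x)} dx`. -/
def valueFn : ℕ → ℝ → ℝ
  | 0, _ => 0
  | k + 1, y => y * valueFn k y + ∫ x in y..1, max (valueFn k y) (1 + valueFn k (1 - x))

/-- The optimal threshold functions `g_k`, for `k ≥ 1` and `y ∈ [0,1]`. -/
def threshold (k : ℕ) (y : ℝ) : ℝ :=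
  sInf {x : ℝ | x ∈ Set.Icc y 1 ∧ valueFn (k - 1) y ≤ 1 + valueFn (k - 1) (1 - x)}

/-- The minimal fixed point `ξ_k` of `g_k` in `[0,1]`. -/
def minFixedPoint (k : ℕ) : ℝ :=
  sInf {y : ℝ | y ∈ Set.Icc 0 1 ∧ threshold k y = y}

/-- `ξ = lim ξ_k`. -/
def xiLimit : ℝ := limUnder atTop minFixedPoint

/-! ### Threshold selection from a sequence of numbers

Observations are numbered from `0`, so `x i` is the `(i+1)`-st observation, and a time horizon
`m` comprises the observations `x 0, …, x (m-1)`. -/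

/-- The (reduced) state before `x i` is seen, when `x i` is selected iff it is at least
the threshold `h i` evaluated at the current state. -/
def thresholdState (h : ℕ → ℝ → ℝ) (x : ℕ → ℝ) : ℕ → ℝ
  | 0 => 0
  | i + 1 =>
    if x i < h i (thresholdState h x i) then thresholdState h x i else 1 - x i

/-- The number of selections among the first `m` observations. -/
def thresholdCount (h : ℕ → ℝ → ℝ) (x : ℕ → ℝ) (m : ℕ) : ℕ :=
  ∑ i ∈ Finset.range m, if h i (thresholdState h x i) ≤ x i then 1 else 0

/-- The number of selections among the first `m ≤ n` observations made by the policy `π*_n`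
with thresholds `g_n, g_{n-1}, …, g_1`. -/
def optimalCount (n : ℕ) (x : ℕ → ℝ) (m : ℕ) : ℕ :=
  thresholdCount (fun i => threshold (n - i)) x m

/-- The number of selections among the first `m` observations made by the policy `π_∞`
with the constant threshold function `y ↦ max ξ y`. -/
def limitCount (x : ℕ → ℝ) (m : ℕ) : ℕ :=
  thresholdCount (fun _ y => max xiLimit y) x m

/-! ### Random observations and feasible policies -/

variable {Ω : Type*} [MeasurableSpace Ω]

/-- The `X i` are independent and uniformly distributed on `[0,1]`. -/
structure IsUniformSample (μ : Measure Ω) (X : ℕ → Ω → ℝ) : Prop where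
  measurable : ∀ i, Measurable (X i)
  indep : iIndepFun X μ
  law : ∀ i, μ.map (X i) = volume.restrict (Set.Icc 0 1)

/-- The `σ`-fields generated by the observations seen so far. -/
def obsFiltration (X : ℕ → Ω → ℝ) (hX : ∀ i, Measurable (X i)) :
    Filtration ℕ (inferInstance : MeasurableSpace Ω) :=
  Filtration.natural X fun i => (hX i).stronglyMeasurable

/-- A feasible policy for the on-line selection of an alternating subsequence
from the observations `X 0, …, X (n-1)`: the successive selection times
`θ 0 < θ 1 < ⋯` are stopping times (with value `⊤` when there is no such selection), and the
selected values satisfy `X_{θ 0} < X_{θ 1} > X_{θ 2} < ⋯`. -/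
structure IsFeasible (X : ℕ → Ω → ℝ) (hX : ∀ i, Measurable (X i)) (n : ℕ)
    (θ : ℕ → Ω → WithTop ℕ) : Prop where
  stopping : ∀ j, IsStoppingTime (obsFiltration X hX) (θ j)
  horizon : ∀ j ω, θ j ω < (n : WithTop ℕ) ∨ θ j ω = ⊤
  monotone : ∀ j ω, θ j ω ≤ θ (j + 1) ω
  strict : ∀ j ω, θ j ω ≠ ⊤ → θ j ω < θ (j + 1) ω
  alternating : ∀ j ω (a b : ℕ), θ j ω = (a : WithTop ℕ) → θ (j + 1) ω = (b : WithTop ℕ) →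
    if Even j then X a ω < X b ω else X b ω < X a ω

/-- The number `A_m` of selections made among the first `m` observations. -/
def numSelections (θ : ℕ → Ω → WithTop ℕ) (m : ℕ) (ω : Ω) : ℕ :=
  {j : ℕ | θ j ω < (m : WithTop ℕ)}.ncard

/-- A feasible policy for `n` observations that maximizes the expected number of selections. -/
structure IsOptimal (μ : Measure Ω) (X : ℕ → Ω → ℝ) (hX : ∀ i, Measurable (X i)) (n : ℕ)
    (θ : ℕ → Ω → WithTop ℕ) : Prop where
  feasible : IsFeasible X hX n θ
  optimal : ∀ θ' : ℕ → Ω → WithTop ℕ, IsFeasible X hX n θ' →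
    ∫ ω, (numSelections θ' n ω : ℝ) ∂μ ≤ ∫ ω, (numSelections θ n ω : ℝ) ∂μ

/-- The centered difference `Δ_n` of the numbers of selections that `π*_n` and `π_∞` make among
the first `n - 2` observations. -/
def centeredDiff (μ : Measure Ω) (X : ℕ → Ω → ℝ) (n : ℕ) (ω : Ω) : ℝ :=
  (optimalCount n (fun i => X i ω) (n - 2) : ℝ)
    - ∫ ω', (optimalCount n (fun i => X i ω') (n - 2) : ℝ) ∂μ
    - (limitCount (fun i => X i ω) (n - 2) : ℝ)
    + ∫ ω', (limitCount (fun i => X i ω') (n - 2) : ℝ) ∂μ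

end AltSelection

end

/-! Thresholds. `minFixedPoint (k+1)` is the point from which `v_k y ≤ 1 + v_k (1 - y)` holds.
Beyond it every observation above the state is acceptable, so the maximum in the Bellman recursion
disappears and the increments `E = v_{k+1} - v_k` obey a linear recursion. That recursion preserves
two shape properties on the part of `[0,1/2]` above the fixed point: `E (1 - y)` increases and `E y
- E (1 - y)` decreases. The latter vanishes at `1/2`, hence is nonnegative, and this sign makes
`ξ_k` increase (`valueFn_increment_monotone`); bounded by `1/2`, the sequence converges.

Optimality. Reflecting each observation that has to lie below the last selected one leaves the
sample independent and uniform, since the decision to reflect depends on the past only. For any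
feasible rule, selections made plus the optimal value of what remains lose a nonnegative expected
amount at each step, and these losses add up to `v_n 0 - E[N_n]` (`sum_integral_loss`). An optimal
rule thus loses nothing almost surely, which determines its decisions up to ties, and ties are null
events.

The `L²` bound. The two policies are driven by the same observations. With `k` observations still to
come, their acceptance regions differ only for observations in `[ξ_{k+1}, ξ + oscBelow k]`; here
`oscBelow` is summable, because halving of oscillations below the fixed point competes only with the
telescoping increments of `ξ_k` (`sum_oscBelow_le`). When at least two observations remain, `ξ_3 =
1/6` keeps the states in `[0,5/6]`, so an observation above `5/6` is selected by both policies and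
moves both to the same state. Differences of values therefore stay bounded, and separated states
merge at a geometric rate. For the martingale `M_i` of conditional expectations of the count
difference, `M_i² + 726 · 1{states differ}` grows in mean by at most a multiple of the disagreement
probability and of the oscillation of the difference of the two value functions
(`integral_step_le`). Summation gives a constant times `∑ (ξ - ξ_k + oscBelow (k-1))`. The summable
part is absorbed because `ξ - ξ_3 > 0`, and Cesàro averaging gives the `o(√n)`. -/

noncomputable section

namespace AltSelection

/-! ### The uniform distribution on the unit interval -/

/-- The uniform distribution on `[0,1]`. -/
def unif : Measure ℝ := volume.restrict (Set.Icc 0 1)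

instance : IsProbabilityMeasure unif := ⟨by simp [unif]⟩

lemma unif_ae_mem : ∀ᵐ x ∂unif, x ∈ Set.Icc (0 : ℝ) 1 :=
  ae_restrict_mem measurableSet_Icc

instance : NullSingletonClass unif := by unfold unif; infer_instance

lemma unif_real_Ico {a b : ℝ} (ha : 0 ≤ a) (hab : a ≤ b) (hb : b ≤ 1) :
    unif.real (Set.Ico a b) = b - a := by
  rw [unif, measureReal_restrict_apply measurableSet_Ico, Set.inter_eq_left.2]
  · simp [hab]
  · exact fun x hx => ⟨ha.trans hx.1, hx.2.le.trans hb⟩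

lemma unif_real_Icc_le {a b : ℝ} (hab : a ≤ b) : unif.real (Set.Icc a b) ≤ b - a := by
  rw [unif, measureReal_restrict_apply measurableSet_Icc]
  refine (measureReal_mono Set.inter_subset_left (by simp)).trans_eq ?_
  simp [hab]

lemma Continuous.integrable_unif {f : ℝ → ℝ} (hf : Continuous f) : Integrable f unif :=
  hf.continuousOn.integrableOn_compact isCompact_Icc

lemma integral_unif (f : ℝ → ℝ) : ∫ x, f x ∂unif = ∫ x in (0 : ℝ)..1, f x := by
  rw [unif, integral_Icc_eq_integral_Ioc, intervalIntegral.integral_of_le zero_le_one]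

lemma integral_unif_indicator_Ico_const {a b : ℝ} (c : ℝ) (ha : 0 ≤ a) (hab : a ≤ b)
    (hb : b ≤ 1) : ∫ x, (Set.Ico a b).indicator (fun _ => c) x ∂unif = (b - a) * c := by
  rw [integral_indicator_const _ measurableSet_Ico, unif_real_Ico ha hab hb, smul_eq_mul]

lemma map_one_sub_unif : unif.map (fun x => 1 - x) = unif := by
  have h := (Measure.measurePreserving_sub_left (volume : Measure ℝ) 1).restrict_preimage
    (measurableSet_Icc (a := (0 : ℝ)) (b := 1))
  have h2 : (fun x : ℝ => 1 - x) ⁻¹' Set.Icc 0 1 = Set.Icc 0 1 := by simp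
  rw [h2] at h
  exact h.map_eq

/-! ### The value functions -/

/-- The expression maximized in the Bellman recursion, as a function of the state `y` and of the
observation `x`. -/
def bellman (v : ℝ → ℝ) (y x : ℝ) : ℝ := if y ≤ x then max (v y) (1 + v (1 - x)) else v y

/-- The observation `x` is acceptable in state `y` if `v` is the value function for the remaining
observations. -/
def Accept (v : ℝ → ℝ) (y x : ℝ) : Prop := y ≤ x ∧ v y ≤ 1 + v (1 - x)

lemma le_bellman (v : ℝ → ℝ) (y x : ℝ) : v y ≤ bellman v y x := by
  unfold bellman; split_ifs <;> simp

lemma bellman_eq_indicator (v : ℝ → ℝ) (y : ℝ) :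
    bellman v y = fun x => v y + (Set.Ici y).indicator (fun x => max 0 (1 + v (1 - x) - v y)) x := by
  ext x
  by_cases h : y ≤ x
  · simp only [bellman, h, if_true, Set.mem_Ici, Set.indicator_of_mem]
    rw [← max_add_add_left]; simp
  · simp [bellman, h]

lemma integrable_bellman {v : ℝ → ℝ} (hv : Continuous v) (y : ℝ) :
    Integrable (bellman v y) unif := by
  rw [bellman_eq_indicator]
  refine (integrable_const _).add (Integrable.indicator ?_ measurableSet_Ici)
  exact Continuous.integrable_unif (by fun_prop)

lemma continuous_valueFn (k : ℕ) : Continuous (valueFn k) := by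
  induction k with
  | zero => exact continuous_const
  | succ k ih =>
    have h : valueFn (k + 1) = fun y => y * valueFn k y -
        ∫ x in (1 : ℝ)..y, max (valueFn k y) (1 + valueFn k (1 - x)) := by
      ext y; rw [valueFn, intervalIntegral.integral_symm]; ring
    rw [h]
    refine (by fun_prop : Continuous fun y => y * valueFn k y).sub ?_
    exact intervalIntegral.continuous_parametric_intervalIntegral_of_continuous
      (f := fun y x => max (valueFn k y) (1 + valueFn k (1 - x))) (by fun_prop) continuous_id

/-- For `x < y` the Bellman integrand is the constant `v y`, so the term `y * v y` merges with the
integral into one expectation over a uniform observation. -/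
lemma valueFn_succ_eq_integral (k : ℕ) {y : ℝ} (hy : y ∈ Set.Icc (0 : ℝ) 1) :
    valueFn (k + 1) y = ∫ x, bellman (valueFn k) y x ∂unif := by
  have hc := continuous_valueFn k
  rw [integral_unif, ← intervalIntegral.integral_add_adjacent_intervals (b := y)]
  · rw [valueFn]
    congr 1
    · rw [intervalIntegral.integral_of_le hy.1, integral_Ioc_eq_integral_Ioo,
        setIntegral_congr_fun (g := fun _ => valueFn k y) measurableSet_Ioo]
      · simp [hy.1]
      · intro x hx
        simp [bellman, hx.2]
    · refine intervalIntegral.integral_congr fun x hx => ?_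
      rw [Set.uIcc_of_le hy.2] at hx
      simp [bellman, hx.1]
  · have := (integrable_bellman hc y)
    rw [unif, ← IntegrableOn] at this
    rw [intervalIntegrable_iff_integrableOn_Icc_of_le hy.1]
    exact this.mono_set (Set.Icc_subset_Icc le_rfl hy.2)
  · have := (integrable_bellman hc y)
    rw [unif, ← IntegrableOn] at this
    rw [intervalIntegrable_iff_integrableOn_Icc_of_le hy.2]
    exact this.mono_set (Set.Icc_subset_Icc hy.1 le_rfl)

lemma bellman_anti {v : ℝ → ℝ} (hv : AntitoneOn v (Set.Icc 0 1)) {y y' : ℝ}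
    (hy : y ∈ Set.Icc (0 : ℝ) 1) (hy' : y' ∈ Set.Icc (0 : ℝ) 1) (h : y ≤ y') (x : ℝ) :
    bellman v y' x ≤ bellman v y x := by
  have := hv hy hy' h
  unfold bellman
  split_ifs with h1 h2 h2
  · gcongr
  · linarith
  · exact this.trans (le_max_left _ _)
  · exact this

lemma antitoneOn_valueFn (k : ℕ) : AntitoneOn (valueFn k) (Set.Icc 0 1) := by
  induction k with
  | zero => intro x _ y _ _; exact le_rfl
  | succ k ih =>
    intro y hy y' hy' h
    rw [valueFn_succ_eq_integral k hy, valueFn_succ_eq_integral k hy']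
    exact integral_mono (integrable_bellman (continuous_valueFn k) _)
      (integrable_bellman (continuous_valueFn k) _) (bellman_anti ih hy hy' h)

/-- A lower bound for the increments of an integral in terms of a lower bound on an interval. -/
lemma mul_le_integral_sub {f g : ℝ → ℝ} (hf : Integrable f unif) (hg : Integrable g unif)
    (hgf : ∀ x ∈ Set.Icc (0 : ℝ) 1, g x ≤ f x) {a b c : ℝ} (ha : 0 ≤ a) (hab : a ≤ b) (hb : b ≤ 1)
    (h : ∀ x ∈ Set.Ico a b, c ≤ f x - g x) :
    (b - a) * c ≤ ∫ x, f x ∂unif - ∫ x, g x ∂unif := by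
  rw [← integral_sub hf hg, ← integral_unif_indicator_Ico_const c ha hab hb]
  refine integral_mono_ae ((integrable_const _).indicator measurableSet_Ico) (hf.sub hg) ?_
  filter_upwards [unif_ae_mem] with x hx
  by_cases hxm : x ∈ Set.Ico a b
  · simpa [hxm] using h x hxm
  · simpa [hxm] using hgf x hx

/-- An observation below the larger state `y'` is useless there, so on `[0,y')`, which has positive
length, the gap between the two states is at least the gap of the preceding value function. The
index starts at `k + 1` because `v_0` is constant. -/
lemma strictAntiOn_valueFn (k : ℕ) : StrictAntiOn (valueFn (k + 1)) (Set.Icc 0 1) := by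
  induction k with
  | zero =>
    have h : ∀ y, valueFn (0 + 1) y = 1 - y := by intro y; simp [valueFn]
    intro x _ y _ hxy
    simp only [h]; linarith
  | succ k ih =>
    intro y hy y' hy' h
    rw [valueFn_succ_eq_integral _ hy, valueFn_succ_eq_integral _ hy']
    have hc := continuous_valueFn (k + 1)
    have h1 := mul_le_integral_sub (integrable_bellman hc y) (integrable_bellman hc y')
      (fun x _ => bellman_anti ih.antitoneOn hy hy' h.le x) (a := 0) (b := y')
      (c := valueFn (k + 1) y - valueFn (k + 1) y') le_rfl hy'.1 hy'.2 (by
        intro x hx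
        have : bellman (valueFn (k + 1)) y' x = valueFn (k + 1) y' := by
          simp [bellman, hx.2]
        have := le_bellman (valueFn (k + 1)) y x
        linarith)
    have h2 := ih hy hy' h
    have : 0 < y' := hy.1.trans_lt h
    have : 0 < (y' - 0) * (valueFn (k + 1) y - valueFn (k + 1) y') :=
      mul_pos (by linarith) (by linarith)
    linarith

lemma one_sub_mem_Icc {x : ℝ} (hx : x ∈ Set.Icc (0 : ℝ) 1) : 1 - x ∈ Set.Icc (0 : ℝ) 1 :=
  ⟨by linarith [hx.2], by linarith [hx.1]⟩

lemma half_mem_Icc : (1 / 2 : ℝ) ∈ Set.Icc (0 : ℝ) 1 := by norm_num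

lemma Accept.mono {k : ℕ} {y x x' : ℝ} (h : Accept (valueFn k) y x) (hx : x ≤ x')
    (h0 : 0 ≤ x) (h1 : x' ≤ 1) : Accept (valueFn k) y x' := by
  refine ⟨h.1.trans hx, h.2.trans ?_⟩
  have := antitoneOn_valueFn k (one_sub_mem_Icc ⟨h0.trans hx, h1⟩)
    (one_sub_mem_Icc ⟨h0, hx.trans h1⟩) (by linarith : 1 - x' ≤ 1 - x)
  linarith

lemma accept_one {k : ℕ} {y : ℝ} (hy : y ∈ Set.Icc (0 : ℝ) 1) : Accept (valueFn k) y 1 := by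
  refine ⟨hy.2, ?_⟩
  have := antitoneOn_valueFn k (Set.left_mem_Icc.2 zero_le_one) hy hy.1
  simp only [sub_self]; linarith

lemma accept_threshold (k : ℕ) {y : ℝ} (hy : y ∈ Set.Icc (0 : ℝ) 1) :
    threshold (k + 1) y ≤ 1 ∧ Accept (valueFn k) y (threshold (k + 1) y) := by
  have hc := continuous_valueFn k
  have hcl : IsClosed {x : ℝ | x ∈ Set.Icc y 1 ∧ valueFn k y ≤ 1 + valueFn k (1 - x)} :=
    isClosed_Icc.and (isClosed_le (by fun_prop) (by fun_prop))
  have hb : BddBelow {x : ℝ | x ∈ Set.Icc y 1 ∧ valueFn k y ≤ 1 + valueFn k (1 - x)} :=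
    ⟨y, fun x hx => hx.1.1⟩
  have hne : {x : ℝ | x ∈ Set.Icc y 1 ∧ valueFn k y ≤ 1 + valueFn k (1 - x)}.Nonempty :=
    ⟨1, ⟨hy.2, le_rfl⟩, (accept_one hy).2⟩
  have := hcl.csInf_mem hne hb
  exact ⟨this.1.2, this.1.1, this.2⟩

lemma threshold_le_iff (k : ℕ) {y x : ℝ} (hy : y ∈ Set.Icc (0 : ℝ) 1)
    (hx : x ∈ Set.Icc (0 : ℝ) 1) :
    threshold (k + 1) y ≤ x ↔ Accept (valueFn k) y x := by
  have h := accept_threshold k hy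
  constructor
  · intro hle
    exact h.2.mono hle (hy.1.trans h.2.1) hx.2
  · intro ha
    exact csInf_le ⟨y, fun x hx => hx.1.1⟩ ⟨⟨ha.1, hx.2⟩, ha.2⟩

lemma threshold_eq_self_iff (k : ℕ) {y : ℝ} (hy : y ∈ Set.Icc (0 : ℝ) 1) :
    threshold (k + 1) y = y ↔ valueFn k y ≤ 1 + valueFn k (1 - y) := by
  constructor
  · intro h
    exact ((threshold_le_iff k hy hy).1 h.le).2
  · intro h
    exact le_antisymm ((threshold_le_iff k hy hy).2 ⟨le_rfl, h⟩) (accept_threshold k hy).2.1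

/-! ### The minimal fixed points -/

/-- Since `v_k` is antitone, `v_k y - v_k (1 - y)` is antitone in `y`. The fixed points thus form a
closed upper part of `[0,1]`, which contains `1/2` by symmetry. -/
lemma minFixedPoint_spec (k : ℕ) : minFixedPoint (k + 1) ∈ Set.Icc (0 : ℝ) (1 / 2) ∧
    ∀ y ∈ Set.Icc (0 : ℝ) 1,
      (valueFn k y ≤ 1 + valueFn k (1 - y) ↔ minFixedPoint (k + 1) ≤ y) := by
  have hc := continuous_valueFn k
  have heq : {y : ℝ | y ∈ Set.Icc 0 1 ∧ threshold (k + 1) y = y} =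
      {y : ℝ | y ∈ Set.Icc 0 1 ∧ valueFn k y ≤ 1 + valueFn k (1 - y)} := by
    ext y
    exact and_congr_right fun hy => threshold_eq_self_iff k hy
  have hcl : IsClosed {y : ℝ | y ∈ Set.Icc 0 1 ∧ valueFn k y ≤ 1 + valueFn k (1 - y)} :=
    isClosed_Icc.and (isClosed_le (by fun_prop) (by fun_prop))
  have hb : BddBelow {y : ℝ | y ∈ Set.Icc 0 1 ∧ valueFn k y ≤ 1 + valueFn k (1 - y)} :=
    ⟨0, fun x hx => hx.1.1⟩
  have hh : (1 / 2 : ℝ) ∈ {y : ℝ | y ∈ Set.Icc 0 1 ∧ valueFn k y ≤ 1 + valueFn k (1 - y)} := by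
    refine ⟨half_mem_Icc, ?_⟩
    norm_num
  have hm : minFixedPoint (k + 1) ∈
      {y : ℝ | y ∈ Set.Icc 0 1 ∧ valueFn k y ≤ 1 + valueFn k (1 - y)} := by
    rw [minFixedPoint, heq]; exact hcl.csInf_mem ⟨_, hh⟩ hb
  refine ⟨⟨hm.1.1, ?_⟩, fun y hy => ⟨fun h => ?_, fun h => ?_⟩⟩
  · rw [minFixedPoint, heq]; exact csInf_le hb hh
  · rw [minFixedPoint, heq]; exact csInf_le hb ⟨hy, h⟩
  · have h1 := antitoneOn_valueFn k hm.1 hy h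
    have h2 := antitoneOn_valueFn k (one_sub_mem_Icc hy) (one_sub_mem_Icc hm.1) (by linarith)
    linarith [hm.2]

lemma minFixedPoint_mem (k : ℕ) : minFixedPoint (k + 1) ∈ Set.Icc (0 : ℝ) 1 :=
  ⟨(minFixedPoint_spec k).1.1, (minFixedPoint_spec k).1.2.trans (by norm_num)⟩

/-! ### Monotonicity of the minimal fixed points -/

/-- Beyond the fixed point the maximum is always attained by selecting, so the recursion becomes
linear in `v_k`. This is what makes the increments tractable. -/
lemma valueFn_succ_of_minFixedPoint_le (k : ℕ) {y : ℝ} (hy : y ∈ Set.Icc (0 : ℝ) 1)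
    (h : minFixedPoint (k + 1) ≤ y) :
    valueFn (k + 1) y = y * valueFn k y + (1 - y) + ∫ x in (0 : ℝ)..(1 - y), valueFn k x := by
  have hc := continuous_valueFn k
  have h1 : ∫ x in y..1, max (valueFn k y) (1 + valueFn k (1 - x)) =
      ∫ x in y..1, (1 + valueFn k (1 - x)) := by
    refine intervalIntegral.integral_congr fun x hx => ?_
    rw [Set.uIcc_of_le hy.2] at hx
    exact max_eq_right (Accept.mono ⟨le_rfl, ((minFixedPoint_spec k).2 y hy).2 h⟩ hx.1 hy.1 hx.2).2
  rw [valueFn, h1, intervalIntegral.integral_add (by simp)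
    ((by fun_prop : Continuous fun x => valueFn k (1 - x)).intervalIntegrable _ _),
    intervalIntegral.integral_comp_sub_left (fun x => valueFn k x)]
  simp
  ring

lemma mul_le_intervalIntegral {f : ℝ → ℝ} (hf : Continuous f) {a b c : ℝ} (hab : a ≤ b)
    (h : ∀ x ∈ Set.Icc a b, c ≤ f x) : (b - a) * c ≤ ∫ x in a..b, f x := by
  have := intervalIntegral.integral_mono_on hab (f := fun _ => c) (by simp)
    (hf.intervalIntegrable (μ := volume) a b) h
  simpa using this

/-- One step of the recursion for the increments of the value functions preserves the
monotonicity of the reflected increment and of its symmetric difference. -/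
lemma monotoneOn_antitoneOn_step {E E' : ℝ → ℝ} (hE : Continuous E) {s : ℝ} (hs : 0 ≤ s)
    (hG : MonotoneOn (fun y => E (1 - y)) (Set.Icc s (1 / 2)))
    (hD : AntitoneOn (fun y => E y - E (1 - y)) (Set.Icc s (1 / 2)))
    (h : ∀ y ∈ Set.Icc s 1, E' y = y * E y + ∫ x in (0 : ℝ)..(1 - y), E x) :
    MonotoneOn (fun y => E' (1 - y)) (Set.Icc s (1 / 2)) ∧
    AntitoneOn (fun y => E' y - E' (1 - y)) (Set.Icc s (1 / 2)) := by
  have hi : ∀ a b, IntervalIntegrable E volume a b := fun a b => hE.intervalIntegrable a b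
  have hD0 : ∀ y ∈ Set.Icc s (1 / 2), 0 ≤ E y - E (1 - y) := by
    intro y hy
    have := hD hy ⟨hy.1.trans hy.2, le_rfl⟩ hy.2
    norm_num at this ⊢
    exact this
  constructor
  · intro y hy y' hy' hyy
    have e1 := h (1 - y) ⟨by linarith [hy.1, hy.2], by linarith [hy.1]⟩
    have e2 := h (1 - y') ⟨by linarith [hy'.1, hy'.2], by linarith [hy'.1]⟩
    simp only [sub_sub_cancel] at e1 e2 ⊢
    rw [e1, e2, ← intervalIntegral.integral_add_adjacent_intervals (hi 0 y) (hi y y')]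
    -- On `[y,y']`, `E x ≥ E (1 - x) ≥ E (1 - y)`: the symmetric difference is nonnegative, and the
    -- reflected increment is monotone.
    have h1 : (y' - y) * E (1 - y) ≤ ∫ x in y..y', E x := by
      refine mul_le_intervalIntegral hE hyy fun x hx => ?_
      have hx' : x ∈ Set.Icc s (1 / 2) := ⟨hy.1.trans hx.1, hx.2.trans hy'.2⟩
      have := hG hy hx' hx.1
      have := hD0 x hx'
      simp only at *
      linarith
    have h2 := hG hy hy' hyy
    simp only at h2
    nlinarith [hy'.2]
  · intro y hy y' hy' hyy
    have e1 := h (1 - y) ⟨by linarith [hy.1, hy.2], by linarith [hy.1]⟩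
    have e2 := h (1 - y') ⟨by linarith [hy'.1, hy'.2], by linarith [hy'.1]⟩
    have e3 := h y ⟨hy.1, by linarith [hy.2]⟩
    have e4 := h y' ⟨hy'.1, by linarith [hy'.2]⟩
    simp only [sub_sub_cancel] at e1 e2 ⊢
    rw [e1, e2, e3, e4]
    have hr : ∫ x in (1 - y')..(1 - y), E x = ∫ x in y..y', E (1 - x) := by
      rw [intervalIntegral.integral_comp_sub_left (fun x => E x)]
    -- Here `E x + E (1 - x) = (E x - E (1 - x)) + 2 E (1 - x)`; the first term is smallest at `y'`,
    -- the second at `y`.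
    have h1 : (y' - y) * ((E y' - E (1 - y')) + 2 * E (1 - y)) ≤
        ∫ x in y..y', (E x + E (1 - x)) := by
      refine mul_le_intervalIntegral (by fun_prop) hyy fun x hx => ?_
      have hx' : x ∈ Set.Icc s (1 / 2) := ⟨hy.1.trans hx.1, hx.2.trans hy'.2⟩
      have := hG hy hx' hx.1
      have := hD hx' hy' hx.2
      simp only at *
      linarith
    rw [intervalIntegral.integral_add (hi _ _)
      ((by fun_prop : Continuous fun x => E (1 - x)).intervalIntegrable _ _), ← hr] at h1
    have h2 := intervalIntegral.integral_add_adjacent_intervals (hi 0 y) (hi y y')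
    have h3 := intervalIntegral.integral_add_adjacent_intervals (hi 0 (1 - y')) (hi (1 - y') (1 - y))
    have h4 := hG hy hy' hyy
    have h5 := hD hy hy' hyy
    simp only at h4 h5
    -- After `h1`, the difference to be shown nonnegative is bounded below by exactly the sum of the
    -- two products in `h6` and `h7`.
    have h6 : 0 ≤ (1 - 2 * y') * (E (1 - y') - E (1 - y)) :=
      mul_nonneg (by linarith [hy'.2]) (by linarith)
    have h7 : 0 ≤ y * ((E y - E (1 - y)) - (E y' - E (1 - y'))) :=
      mul_nonneg (hs.trans hy.1) (by linarith)
    rw [← h2, ← h3]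
    linarith

/-- At `s = ξ_{k+1}` the gap `v_k s - v_k (1 - s)` equals `1` unless `s = 0`. If the increment does
not shrink it, the gap of `v_{k+1}` is at least `1` at `s` and, by strict monotonicity, exceeds `1`
to the left of `s`. -/
lemma minFixedPoint_le_of_increment {k : ℕ}
    (hD : 0 ≤ (valueFn (k + 1) (minFixedPoint (k + 1)) - valueFn k (minFixedPoint (k + 1))) -
      (valueFn (k + 1) (1 - minFixedPoint (k + 1)) - valueFn k (1 - minFixedPoint (k + 1)))) :
    minFixedPoint (k + 1) ≤ minFixedPoint (k + 2) := by
  by_contra! hlt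
  have hs := minFixedPoint_mem k
  have hz := minFixedPoint_mem (k + 1)
  have h1 := ((minFixedPoint_spec (k + 1)).2 _ hz).2 le_rfl
  have h2 := strictAntiOn_valueFn k hz hs hlt
  have h3 := strictAntiOn_valueFn k (one_sub_mem_Icc hs) (one_sub_mem_Icc hz) (by linarith)
  set s := minFixedPoint (k + 1) with hsdef
  -- The inequality comes from a limit from the left, so it needs points of `[0,1]` below `s`; the
  -- assumption `hlt` provides them.
  have h4 : 1 + valueFn k (1 - s) ≤ valueFn k s := by
    have hc := continuous_valueFn k
    have hcl : IsClosed {y : ℝ | 1 + valueFn k (1 - y) ≤ valueFn k y} :=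
      isClosed_le (by fun_prop) (by fun_prop)
    have hsub : Set.Ioo (minFixedPoint (k + 2)) s ⊆ {y : ℝ | 1 + valueFn k (1 - y) ≤ valueFn k y} := by
      intro y hy
      have := ((minFixedPoint_spec k).2 y ⟨hz.1.trans hy.1.le, hy.2.le.trans hs.2⟩).not.2
        (not_le.2 hy.2)
      exact (not_le.1 this).le
    have := closure_minimal hsub hcl
    rw [closure_Ioo hlt.ne] at this
    exact this (Set.right_mem_Icc.2 hlt.le)
  linarith

/-- The three claims have to be proved together: the inequality between fixed points puts the next
interval inside the present one, where the linear recursion is available for both `v_{k+1}` and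
`v_{k+2}`. It follows in turn from the antitone difference, which is zero at `1/2`. -/
lemma valueFn_increment_monotone (k : ℕ) :
    MonotoneOn (fun y => valueFn (k + 1) (1 - y) - valueFn k (1 - y))
      (Set.Icc (minFixedPoint (k + 1)) (1 / 2)) ∧
    AntitoneOn (fun y => (valueFn (k + 1) y - valueFn k y) -
      (valueFn (k + 1) (1 - y) - valueFn k (1 - y))) (Set.Icc (minFixedPoint (k + 1)) (1 / 2)) ∧
    minFixedPoint (k + 1) ≤ minFixedPoint (k + 2) := by
  have key : ∀ k, AntitoneOn (fun y => (valueFn (k + 1) y - valueFn k y) -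
      (valueFn (k + 1) (1 - y) - valueFn k (1 - y))) (Set.Icc (minFixedPoint (k + 1)) (1 / 2)) →
      minFixedPoint (k + 1) ≤ minFixedPoint (k + 2) := by
    intro k hD
    apply minFixedPoint_le_of_increment
    have hs := (minFixedPoint_spec k).1
    have := hD ⟨le_rfl, hs.2⟩ ⟨hs.2, le_rfl⟩ hs.2
    norm_num at this ⊢
    exact this
  induction k with
  | zero =>
    have h : ∀ y, valueFn (0 + 1) y = 1 - y := by intro y; simp [valueFn]
    have h0 : ∀ y, valueFn 0 y = 0 := fun y => rfl
    have hD : AntitoneOn (fun y => (valueFn (0 + 1) y - valueFn 0 y) -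
        (valueFn (0 + 1) (1 - y) - valueFn 0 (1 - y)))
        (Set.Icc (minFixedPoint (0 + 1)) (1 / 2)) := by
      intro x _ y _ hxy; simp only [h, h0]; linarith
    exact ⟨by intro x _ y _ hxy; simp only [h, h0]; linarith, hD, key 0 hD⟩
  | succ k ih =>
    obtain ⟨hG, hD, hle⟩ := ih
    have hc := continuous_valueFn k
    have hc' := continuous_valueFn (k + 1)
    have hs := minFixedPoint_mem (k + 1)
    have hsub : Set.Icc (minFixedPoint (k + 2)) (1 / 2 : ℝ) ⊆
        Set.Icc (minFixedPoint (k + 1)) (1 / 2) := Set.Icc_subset_Icc_left hle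
    have := monotoneOn_antitoneOn_step (E := fun y => valueFn (k + 1) y - valueFn k y)
      (E' := fun y => valueFn (k + 2) y - valueFn (k + 1) y) (by fun_prop) hs.1
      (hG.mono hsub) (hD.mono hsub) (by
        intro y hy
        have hy' : y ∈ Set.Icc (0 : ℝ) 1 := ⟨hs.1.trans hy.1, hy.2⟩
        rw [intervalIntegral.integral_sub (hc'.intervalIntegrable _ _) (hc.intervalIntegrable _ _)]
        linear_combination valueFn_succ_of_minFixedPoint_le (k + 1) hy' hy.1 -
          valueFn_succ_of_minFixedPoint_le k hy' (hle.trans hy.1))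
    exact ⟨this.1, this.2, key _ this.2⟩

lemma monotone_minFixedPoint : Monotone fun k => minFixedPoint (k + 1) :=
  monotone_nat_of_le_succ fun k => (valueFn_increment_monotone k).2.2

lemma tendsto_minFixedPoint : Tendsto minFixedPoint atTop (𝓝 xiLimit) := by
  have hb : BddAbove (Set.range fun k => minFixedPoint (k + 1)) :=
    ⟨1 / 2, by rintro _ ⟨k, rfl⟩; exact (minFixedPoint_spec k).1.2⟩
  have h := (tendsto_add_atTop_iff_nat 1).1 (tendsto_atTop_ciSup monotone_minFixedPoint hb)
  have h2 : xiLimit = ⨆ k, minFixedPoint (k + 1) := h.limUnder_eq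
  rwa [h2]

lemma minFixedPoint_le_xiLimit (k : ℕ) : minFixedPoint (k + 1) ≤ xiLimit :=
  monotone_minFixedPoint.ge_of_tendsto ((tendsto_add_atTop_iff_nat 1).2 tendsto_minFixedPoint) k

lemma xiLimit_le_half : xiLimit ≤ 1 / 2 :=
  le_of_tendsto ((tendsto_add_atTop_iff_nat 1).2 tendsto_minFixedPoint)
    (Eventually.of_forall fun k => (minFixedPoint_spec k).1.2)

/-! ### Estimates on the lower and the upper half of the unit interval -/

/-- From either state in the lower half, an observation `x ≥ 1/2` is selected and leads to the same
state `1 - x`. Only `x < 1/2` carries the old gap along, which yields the factor `1/2`; the extra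
`c` is paid only for `x` between the two states. -/
lemma valueFn_contract_aux (k : ℕ) (hm : valueFn k 0 ≤ 1 + valueFn k (1 / 2)) {y y' c : ℝ}
    (hy : 0 ≤ y) (hyy : y ≤ y') (hy' : y' ≤ 1 / 2)
    (h : ∀ x ∈ Set.Ico y y', 1 + valueFn k (1 - x) ≤ valueFn k y + c) (hc0 : 0 ≤ c) :
    valueFn (k + 1) y - valueFn (k + 1) y' ≤
      1 / 2 * (valueFn k y - valueFn k y') + (y' - y) * c := by
  have hc := continuous_valueFn k
  have ha := antitoneOn_valueFn k
  have hmy : y ∈ Set.Icc (0 : ℝ) 1 := ⟨hy, by linarith⟩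
  have hmy' : y' ∈ Set.Icc (0 : ℝ) 1 := ⟨by linarith, by linarith⟩
  have hd := ha hmy hmy' hyy
  have hy0 := ha (Set.left_mem_Icc.2 zero_le_one) hmy hy
  have hy0' := ha (Set.left_mem_Icc.2 zero_le_one) hmy' (hy.trans hyy)
  rw [valueFn_succ_eq_integral k hmy, valueFn_succ_eq_integral k hmy',
    ← integral_sub (integrable_bellman hc _) (integrable_bellman hc _)]
  have e1 := integral_unif_indicator_Ico_const (a := 0) (b := 1 / 2)
    (valueFn k y - valueFn k y') le_rfl (by norm_num) (by norm_num)
  have e2 := integral_unif_indicator_Ico_const (a := y) (b := y') c hy hyy hmy'.2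
  have i1 : Integrable ((Set.Ico (0 : ℝ) (1 / 2)).indicator
    (fun _ => valueFn k y - valueFn k y')) unif :=
    (integrable_const _).indicator measurableSet_Ico
  have i2 : Integrable ((Set.Ico y y').indicator (fun _ => c)) unif :=
    (integrable_const _).indicator measurableSet_Ico
  rw [sub_zero] at e1
  rw [← e1, ← e2, ← integral_add i1 i2]
  refine integral_mono_ae ((integrable_bellman hc _).sub (integrable_bellman hc _)) (i1.add i2) ?_
  filter_upwards [unif_ae_mem] with x hx
  simp only [Set.indicator, Set.mem_Ico, hx.1, true_and]
  by_cases hxh : x < 1 / 2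
  · simp only [hxh, if_true, bellman]
    by_cases h1 : y ≤ x
    · by_cases h2 : y' ≤ x
      · simp only [h1, h2, if_true, not_lt.2 h2, and_false, if_false, add_zero]
        have : max (valueFn k y) (1 + valueFn k (1 - x)) ≤
          max (valueFn k y') (1 + valueFn k (1 - x)) + (valueFn k y - valueFn k y') := by
          apply max_le
          · linarith [le_max_left (valueFn k y') (1 + valueFn k (1 - x))]
          · linarith [le_max_right (valueFn k y') (1 + valueFn k (1 - x))]
        linarith
      · simp only [h1, h2, if_true, not_le.1 h2, and_self, if_false]
        have := h x ⟨h1, not_le.1 h2⟩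
        have : max (valueFn k y) (1 + valueFn k (1 - x)) ≤ valueFn k y + c :=
          max_le (by linarith) this
        linarith
    · have h2 : ¬ y' ≤ x := fun h => h1 (hyy.trans h)
      simp only [h1, h2, if_false, false_and, add_zero, le_refl]
  · have h1 : y ≤ x := by linarith
    have h2 : y' ≤ x := by linarith
    have h3 := ha (one_sub_mem_Icc hx) half_mem_Icc (by linarith)
    simp only [bellman, hxh, h1, h2, if_true, if_false, not_lt.2 h2, and_false, add_zero]
    rw [max_eq_right (by linarith), max_eq_right (by linarith)]
    simp

/-- A bound `1` for the drop over `[0,1/2]` reproduces itself, as `1/2 * 1 + 1/2 * 1 = 1`. -/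
lemma valueFn_zero_le (k : ℕ) : valueFn k 0 ≤ 1 + valueFn k (1 / 2) := by
  induction k with
  | zero => simp [valueFn]
  | succ k ih =>
    have := valueFn_contract_aux k ih (y := 0) (y' := 1 / 2) (c := 1) le_rfl (by norm_num) le_rfl
      (by
        intro x hx
        have h1 := antitoneOn_valueFn k half_mem_Icc (one_sub_mem_Icc ⟨hx.1, by linarith [hx.2]⟩)
          (by linarith [hx.2])
        have h2 := antitoneOn_valueFn k (Set.left_mem_Icc.2 zero_le_one) half_mem_Icc
          (by norm_num)
        linarith) zero_le_one
    linarith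

/-- The Lipschitz constant `2` is the fixed point of `t ↦ t / 2 + 1`. -/
lemma valueFn_sub_le (k : ℕ) {y y' : ℝ} (hy : 0 ≤ y) (hyy : y ≤ y') (hy' : y' ≤ 1 / 2) :
    valueFn k y - valueFn k y' ≤ 2 * (y' - y) := by
  induction k with
  | zero => simp [valueFn]; linarith
  | succ k ih =>
    have := valueFn_contract_aux k (valueFn_zero_le k) (c := 1) hy hyy hy' (by
        intro x hx
        have hx2 : x < 1 / 2 := hx.2.trans_le hy'
        have h1 := antitoneOn_valueFn k half_mem_Icc
          (one_sub_mem_Icc ⟨hy.trans hx.1, by linarith⟩) (by linarith)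
        have h2 := antitoneOn_valueFn k ⟨hy, by linarith⟩ half_mem_Icc (by linarith)
        linarith) zero_le_one
    linarith

/-- Below the fixed point nothing between the states is worth selecting, so the extra cost is `c =
0`. -/
lemma valueFn_contract (k : ℕ) {y y' : ℝ} (hy : 0 ≤ y) (hyy : y ≤ y')
    (hy' : y' ≤ minFixedPoint (k + 1)) :
    valueFn (k + 1) y - valueFn (k + 1) y' ≤ 1 / 2 * (valueFn k y - valueFn k y') := by
  have hs := minFixedPoint_spec k
  have := valueFn_contract_aux k (valueFn_zero_le k) (c := 0) hy hyy (hy'.trans hs.1.2) (by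
        intro x hx
        have hx1 : x ∈ Set.Icc (0 : ℝ) 1 :=
          ⟨hy.trans hx.1, by linarith [hx.2, hs.1.2]⟩
        have h1 := (hs.2 x hx1).not.2 (not_le.2 (hx.2.trans_le hy'))
        have h2 := antitoneOn_valueFn k ⟨hy, by linarith [hs.1.2]⟩ hx1 hx.1
        linarith) le_rfl
  linarith

/-- For `x ∈ [y,y')` only state `y` may select, and it then moves to `1 - x ≤ 1/2 ≤ y'`, a state at
least as good as `y'`. This is worth at least one full selection. -/
lemma sub_le_valueFn_sub (k : ℕ) {y y' : ℝ} (hy : 1 / 2 ≤ y) (hyy : y ≤ y') (hy' : y' ≤ 1) :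
    y' - y ≤ valueFn (k + 1) y - valueFn (k + 1) y' := by
  have hmy : y ∈ Set.Icc (0 : ℝ) 1 := ⟨by linarith, by linarith⟩
  have hmy' : y' ∈ Set.Icc (0 : ℝ) 1 := ⟨by linarith, by linarith⟩
  rw [valueFn_succ_eq_integral k hmy, valueFn_succ_eq_integral k hmy', ← mul_one (y' - y)]
  have hc := continuous_valueFn k
  refine mul_le_integral_sub (integrable_bellman hc y) (integrable_bellman hc y')
    (fun x _ => bellman_anti (antitoneOn_valueFn k) hmy hmy' hyy x) hmy.1 hyy hy' ?_
  intro x hx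
  simp only [bellman, hx.1, not_le.2 hx.2, if_true, if_false]
  have := antitoneOn_valueFn k (one_sub_mem_Icc ⟨hmy.1.trans hx.1, by linarith [hx.2]⟩) hmy'
    (by linarith [hx.1])
  linarith [le_max_right (valueFn k y) (1 + valueFn k (1 - x))]

lemma accept_of_half_le (k : ℕ) {y x : ℝ} (hy : y ∈ Set.Icc (0 : ℝ) 1) (hx1 : x ≤ 1)
    (hx : 1 / 2 ≤ x) (hyx : y ≤ x) : Accept (valueFn k) y x := by
  refine ⟨hyx, ?_⟩
  have h1 := antitoneOn_valueFn k (Set.left_mem_Icc.2 zero_le_one) hy hy.1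
  have h2 := antitoneOn_valueFn k (one_sub_mem_Icc ⟨by linarith, hx1⟩) half_mem_Icc (by linarith)
  linarith [valueFn_zero_le k]

/-- The oscillation of the value function `v_k` below the minimal fixed point `ξ_{k+1}`. -/
def oscBelow (k : ℕ) : ℝ := valueFn k 0 - valueFn k (minFixedPoint (k + 1))

lemma oscBelow_nonneg (k : ℕ) : 0 ≤ oscBelow k :=
  sub_nonneg.2 (antitoneOn_valueFn k (Set.left_mem_Icc.2 zero_le_one) (minFixedPoint_mem k)
    (minFixedPoint_mem k).1)

/-- Contraction handles the old interval `[0, ξ_{k+1}]`, and the Lipschitz bound handles the piece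
added by the increase of the fixed point. -/
lemma oscBelow_succ_le (k : ℕ) :
    oscBelow (k + 1) ≤ 1 / 2 * oscBelow k + 2 * (minFixedPoint (k + 2) - minFixedPoint (k + 1)) := by
  have h1 := valueFn_contract k le_rfl (minFixedPoint_mem k).1 le_rfl
  have h2 := valueFn_sub_le (k + 1) (minFixedPoint_mem k).1 (valueFn_increment_monotone k).2.2
    (minFixedPoint_spec (k + 1)).1.2
  unfold oscBelow
  linarith

lemma sum_oscBelow_le (n : ℕ) : ∑ k ∈ Finset.range n, oscBelow k ≤ 2 := by
  -- The term `2 * oscBelow n` turns the contraction into a telescoping estimate; the right side is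
  -- at most `2` since fixed points are at most `1/2`.
  have h : ∀ n, ∑ k ∈ Finset.range n, oscBelow k + 2 * oscBelow n ≤
      4 * (minFixedPoint (n + 1)) := by
    intro n
    induction n with
    | zero =>
      have : oscBelow 0 = 0 := by simp [oscBelow, valueFn]
      simp [this, (minFixedPoint_mem 0).1]
    | succ n ih =>
      rw [Finset.sum_range_succ]
      linarith [oscBelow_succ_le n]
  linarith [h n, oscBelow_nonneg n, (minFixedPoint_spec n).1.2]

lemma Accept.minFixedPoint_le {k : ℕ} {y x : ℝ} (hy : y ∈ Set.Icc (0 : ℝ) 1)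
    (hx : x ∈ Set.Icc (0 : ℝ) 1) (h : Accept (valueFn k) y x) : minFixedPoint (k + 1) ≤ x :=
  ((minFixedPoint_spec k).2 x hx).1 ((antitoneOn_valueFn k hy hx h.1).trans h.2)

/-- Passing from the fixed point to `x` raises `v_k (1 - x)` by at least `x - ξ_{k+1}`, by the slope
bound on the upper half. An excess of `oscBelow k` therefore compensates for the best possible state
`0`. -/
lemma accept_of_minFixedPoint_add_le (k : ℕ) {y x : ℝ} (hy : y ∈ Set.Icc (0 : ℝ) 1)
    (hx : x ∈ Set.Icc (0 : ℝ) 1) (hyx : y ≤ x) (h : minFixedPoint (k + 1) + oscBelow k ≤ x) :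
    Accept (valueFn k) y x := by
  have hs := minFixedPoint_spec k
  have hm := minFixedPoint_mem k
  rcases le_total (1 / 2) x with h2 | h2
  · exact accept_of_half_le k hy hx.2 h2 hyx
  refine ⟨hyx, ?_⟩
  have h0 := antitoneOn_valueFn k (Set.left_mem_Icc.2 zero_le_one) hy hy.1
  have h1 := (hs.2 _ hm).2 le_rfl
  cases k with
  | zero => simp [valueFn]
  | succ k =>
    have h3 := sub_le_valueFn_sub k (y := 1 - x) (y' := 1 - minFixedPoint (k + 2)) (by linarith)
      (by linarith [oscBelow_nonneg (k + 1)]) (by linarith [hm.1])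
    have : oscBelow (k + 1) = valueFn (k + 1) 0 - valueFn (k + 1) (minFixedPoint (k + 2)) := rfl
    linarith

/-! ### The first minimal fixed points -/

/-- Explicit computation of `v_2` and `v_3`. The value `1/6` confines the states to `[0,5/6]`; the
strict inequality makes `ξ - ξ_3` positive, as needed to absorb an additive constant in the final
bound. -/
lemma minFixedPoint_three : minFixedPoint 3 = 1 / 6 ∧ 1 / 6 < minFixedPoint 4 := by
  have v1 : ∀ y, valueFn 1 y = 1 - y := by intro y; simp [valueFn]
  have x2 : minFixedPoint 2 ≤ 0 := ((minFixedPoint_spec 1).2 0 (by simp)).1 (by simp [v1])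
  have v2 : ∀ y ∈ Set.Icc (0 : ℝ) 1, valueFn 2 y = 3 / 2 * (1 - y ^ 2) := by
    intro y hy
    rw [valueFn_succ_of_minFixedPoint_le 1 hy (x2.trans hy.1)]
    simp only [v1]
    rw [intervalIntegral.integral_sub (by simp) (by simp)]
    simp
    ring
  have x3 : minFixedPoint 3 ≤ 1 / 6 := ((minFixedPoint_spec 2).2 (1 / 6) (by norm_num)).1 (by
    rw [v2 _ (by norm_num), v2 _ (by norm_num)]; norm_num)
  have v3 : ∀ y ∈ Set.Icc (1 / 6 : ℝ) 1, valueFn 3 y =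
      y * (3 / 2 * (1 - y ^ 2)) + (1 - y) + 3 / 2 * ((1 - y) - (1 - y) ^ 3 / 3) := by
    intro y hy
    have hy' : y ∈ Set.Icc (0 : ℝ) 1 := ⟨by linarith [hy.1], hy.2⟩
    rw [valueFn_succ_of_minFixedPoint_le 2 hy' (x3.trans hy.1), v2 y hy']
    congr 1
    rw [intervalIntegral.integral_congr (g := fun x => 3 / 2 * (1 - x ^ 2))]
    · rw [intervalIntegral.integral_const_mul, intervalIntegral.integral_sub (by simp) (by simp)]
      simp
      norm_num
    · intro x hx
      rw [Set.uIcc_of_le (by linarith [hy.2])] at hx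
      exact v2 x ⟨hx.1, by linarith [hx.2, hy'.1]⟩
  refine ⟨le_antisymm x3 ?_, ?_⟩
  · have h := ((minFixedPoint_spec 2).2 _ (minFixedPoint_mem 2)).2 le_rfl
    rw [v2 _ (minFixedPoint_mem 2), v2 _ (one_sub_mem_Icc (minFixedPoint_mem 2))] at h
    norm_num at h ⊢
    nlinarith
  · by_contra! h
    have := ((minFixedPoint_spec 3).2 (1 / 6) (by norm_num)).2 h
    rw [v3 _ (by norm_num), v3 _ (by norm_num)] at this
    norm_num at this

lemma minFixedPoint_three_lt_xiLimit : minFixedPoint 3 < xiLimit := by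
  rw [minFixedPoint_three.1]
  exact minFixedPoint_three.2.trans_le (minFixedPoint_le_xiLimit 3)

lemma one_sixth_le_minFixedPoint {k : ℕ} (hk : 2 ≤ k) : 1 / 6 ≤ minFixedPoint (k + 1) :=
  minFixedPoint_three.1.symm.le.trans (monotone_minFixedPoint hk)

/-! ### Conditioning on the past -/

section Past

/-- The `σ`-field generated by the first `i` observations. -/
@[reducible] def past {Ω : Type*} (X : ℕ → Ω → ℝ) (i : ℕ) : MeasurableSpace Ω :=
  ⨆ j < i, MeasurableSpace.comap (X j) inferInstance

lemma past_mono {Ω : Type*} (X : ℕ → Ω → ℝ) {i i' : ℕ} (h : i ≤ i') : past X i ≤ past X i' :=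
  biSup_mono fun _ hj => lt_of_lt_of_le hj h

variable {Ω : Type*} {m : MeasurableSpace Ω} [mΩ : MeasurableSpace Ω] {μ : Measure Ω}
  {X : ℕ → Ω → ℝ}

lemma past_le (hX : ∀ i, Measurable (X i)) (i : ℕ) : past X i ≤ mΩ :=
  iSup₂_le fun j _ => (hX j).comap_le

lemma measurable_past {Ω : Type*} (X : ℕ → Ω → ℝ) {i j : ℕ} (h : j < i) : Measurable[past X i] (X j) :=
  measurable_iff_comap_le.2
    (le_iSup₂ (f := fun j (_ : j < i) => MeasurableSpace.comap (X j) inferInstance) j h)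

lemma obsFiltration_eq_past (hX : ∀ i, Measurable (X i)) (i : ℕ) :
    obsFiltration X hX i = past X (i + 1) := by
  simp only [past, Nat.lt_succ_iff]
  rfl

lemma IsUniformSample.indep_past (h : IsUniformSample μ X) (i : ℕ) :
    Indep (past X i) (MeasurableSpace.comap (X i) inferInstance) μ := by
  have := indep_iSup_of_disjoint (fun j => (h.measurable j).comap_le)
    ((iIndepFun_iff_iIndep _ _ _).1 h.indep) (S := Set.Iio i) (T := {i}) (by simp)
  simpa [past] using this

/-- Fubini for the product law of `(S, T)`; it plays the role of conditioning on the past. -/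
lemma integral_comp_indep [IsProbabilityMeasure μ] {α : Type*} [MeasurableSpace α] {S : Ω → α}
    {T : Ω → ℝ} (hm : m ≤ mΩ) (hS : Measurable[m] S) (hT : Measurable T)
    (hi : Indep m (MeasurableSpace.comap T inferInstance) μ) (hl : μ.map T = unif)
    {φ : α × ℝ → ℝ} (hφ : Measurable φ) (hint : Integrable (fun ω => φ (S ω, T ω)) μ) :
    Integrable (fun ω => ∫ x, φ (S ω, x) ∂unif) μ ∧
      ∫ ω, φ (S ω, T ω) ∂μ = ∫ ω, ∫ x, φ (S ω, x) ∂unif ∂μ := by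
  have hS' : Measurable S := hS.mono hm le_rfl
  have hind : IndepFun S T μ :=
    (IndepFun_iff_Indep _ _ _).2 (indep_of_indep_of_le_left hi hS.comap_le)
  have hmap := (indepFun_iff_map_prod_eq_prod_map_map hS'.aemeasurable hT.aemeasurable).1 hind
  rw [hl] at hmap
  have : IsProbabilityMeasure (μ.map S) := Measure.isProbabilityMeasure_map hS'.aemeasurable
  have hint' : Integrable φ ((μ.map S).prod unif) := by
    rw [← hmap, integrable_map_measure hφ.aestronglyMeasurable (hS'.prodMk hT).aemeasurable]
    exact hint
  have h1 := hint'.integral_prod_left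
  constructor
  · exact (integrable_map_measure h1.aestronglyMeasurable hS'.aemeasurable).1 h1
  · rw [← integral_map (f := φ) (hS'.prodMk hT).aemeasurable hφ.aestronglyMeasurable, hmap,
      integral_prod _ hint', integral_map hS'.aemeasurable h1.aestronglyMeasurable]

lemma integral_comp_indep_le [IsProbabilityMeasure μ] {α : Type*} [MeasurableSpace α] {S : Ω → α}
    {T : Ω → ℝ} (hm : m ≤ mΩ) (hS : Measurable[m] S) (hT : Measurable T)
    (hi : Indep m (MeasurableSpace.comap T inferInstance) μ) (hl : μ.map T = unif)
    {φ : α × ℝ → ℝ} (hφ : Measurable φ) (hint : Integrable (fun ω => φ (S ω, T ω)) μ)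
    {ψ : Ω → ℝ} (hψ : Integrable ψ μ) (h : ∀ᵐ ω ∂μ, ∫ x, φ (S ω, x) ∂unif ≤ ψ ω) :
    ∫ ω, φ (S ω, T ω) ∂μ ≤ ∫ ω, ψ ω ∂μ := by
  obtain ⟨h1, h2⟩ := integral_comp_indep hm hS hT hi hl hφ hint
  rw [h2]
  exact integral_mono_ae h1 hψ h

lemma IsUniformSample.ae_mem (h : IsUniformSample μ X) :
    ∀ᵐ ω ∂μ, ∀ i, X i ω ∈ Set.Icc (0 : ℝ) 1 := by
  rw [ae_all_iff]
  intro i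
  have : ∀ᵐ x ∂(μ.map (X i)), x ∈ Set.Icc (0 : ℝ) 1 := by rw [h.law i]; exact unif_ae_mem
  exact ae_of_ae_map (h.measurable i).aemeasurable this

lemma integrable_of_bounded [IsFiniteMeasure μ] {f : Ω → ℝ} (hf : Measurable f) (C : ℝ)
    (h : ∀ ω, |f ω| ≤ C) : Integrable f μ :=
  Integrable.of_bound hf.aestronglyMeasurable C (Eventually.of_forall h)

end Past

/-! ### Selection with general acceptance regions -/

open Classical in
/-- The state after the observation `x` in state `y`, for the acceptance region `A`. -/
def nextState (A : Set (ℝ × ℝ)) (y x : ℝ) : ℝ := if (y, x) ∈ A then 1 - x else y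

open Classical in
/-- The number of selections, `0` or `1`, when `x` is observed in state `y`. -/
def gain (A : Set (ℝ × ℝ)) (y x : ℝ) : ℝ := if (y, x) ∈ A then 1 else 0

/-- The state after `i` observations `x`, when the regions `A i` are used one after another. -/
def runState (A : ℕ → Set (ℝ × ℝ)) (x : ℕ → ℝ) : ℕ → ℝ
  | 0 => 0
  | i + 1 => nextState (A i) (runState A x i) (x i)

/-- The expected number of selections among `r` observations, from the state `y`, when the region
`A j` is used for the observation that is followed by `j` others. -/
def runValue (A : ℕ → Set (ℝ × ℝ)) : ℕ → ℝ → ℝ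
  | 0, _ => 0
  | r + 1, y => ∫ x, (gain (A r) y x + runValue A r (nextState (A r) y x)) ∂unif

lemma measurable_nextState {A : Set (ℝ × ℝ)} (hA : MeasurableSet A) :
    Measurable fun p : ℝ × ℝ => nextState A p.1 p.2 :=
  Measurable.ite hA (measurable_const.sub measurable_snd) measurable_fst

lemma measurable_gain {A : Set (ℝ × ℝ)} (hA : MeasurableSet A) :
    Measurable fun p : ℝ × ℝ => gain A p.1 p.2 :=
  Measurable.ite hA measurable_const measurable_const

lemma gain_nonneg (A : Set (ℝ × ℝ)) (y x : ℝ) : 0 ≤ gain A y x := by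
  unfold gain; split_ifs <;> norm_num

lemma gain_le_one (A : Set (ℝ × ℝ)) (y x : ℝ) : gain A y x ≤ 1 := by
  unfold gain; split_ifs <;> norm_num

section RunValue
variable {A : ℕ → Set (ℝ × ℝ)}

lemma measurable_runValue (hA : ∀ r, MeasurableSet (A r)) (r : ℕ) : Measurable (runValue A r) := by
  induction r with
  | zero => exact measurable_const
  | succ r ih =>
    have : Measurable fun p : ℝ × ℝ =>
        gain (A r) p.1 p.2 + runValue A r (nextState (A r) p.1 p.2) :=
      (measurable_gain (hA r)).add (ih.comp (measurable_nextState (hA r)))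
    exact (this.stronglyMeasurable.integral_prod_right (ν := unif)).measurable

lemma abs_runValue_le (A : ℕ → Set (ℝ × ℝ)) (r : ℕ) (y : ℝ) : |runValue A r y| ≤ r := by
  induction r generalizing y with
  | zero => simp [runValue]
  | succ r ih =>
    have := norm_integral_le_of_norm_le_const (μ := unif) (C := (r + 1 : ℝ))
      (f := fun x => gain (A r) y x + runValue A r (nextState (A r) y x))
      (Eventually.of_forall fun x => by
        rw [Real.norm_eq_abs]
        refine (abs_add_le _ _).trans ?_
        rw [abs_of_nonneg (gain_nonneg _ _ _)]
        linarith [ih (nextState (A r) y x), gain_le_one (A r) y x])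
    simpa [runValue] using this

lemma measurable_stepValue (hA : ∀ r, MeasurableSet (A r)) (r : ℕ) :
    Measurable fun p : ℝ × ℝ => gain (A r) p.1 p.2 + runValue A r (nextState (A r) p.1 p.2) :=
  (measurable_gain (hA r)).add ((measurable_runValue hA r).comp (measurable_nextState (hA r)))

lemma abs_stepValue_le (A : ℕ → Set (ℝ × ℝ)) (r : ℕ) (y x : ℝ) :
    |gain (A r) y x + runValue A r (nextState (A r) y x)| ≤ r + 1 := by
  refine (abs_add_le _ _).trans ?_
  rw [abs_of_nonneg (gain_nonneg _ _ _)]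
  linarith [abs_runValue_le A r (nextState (A r) y x), gain_le_one (A r) y x]

lemma integrable_stepValue (hA : ∀ r, MeasurableSet (A r)) (r : ℕ) (y : ℝ) :
    Integrable (fun x => gain (A r) y x + runValue A r (nextState (A r) y x)) unif :=
  integrable_of_bounded ((measurable_stepValue hA r).comp measurable_prodMk_left) _
    (abs_stepValue_le A r y)

end RunValue

/-! ### Second moments for two coupled selection processes -/

/-- The acceptance regions `A r` keep the states in `[0, 5/6]`, and contain all large
observations. -/
structure Merging (A : ℕ → Set (ℝ × ℝ)) : Prop where
  meas : ∀ r, MeasurableSet (A r)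
  low : ∀ r, ∀ y ∈ Set.Icc (0 : ℝ) (5 / 6), ∀ x ∈ Set.Icc (0 : ℝ) 1, (y, x) ∈ A r → 1 / 6 ≤ x
  high : ∀ r, ∀ y ∈ Set.Icc (0 : ℝ) (5 / 6), ∀ x ∈ Set.Icc (5 / 6 : ℝ) 1, (y, x) ∈ A r

namespace Merging
variable {A : ℕ → Set (ℝ × ℝ)}

lemma nextState_mem (h : Merging A) (r : ℕ) {y x : ℝ} (hy : y ∈ Set.Icc (0 : ℝ) (5 / 6))
    (hx : x ∈ Set.Icc (0 : ℝ) 1) : nextState (A r) y x ∈ Set.Icc (0 : ℝ) (5 / 6) := by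
  unfold nextState
  split_ifs with hm
  · have := h.low r y hy x hx hm
    exact ⟨by linarith [hx.2], by linarith⟩
  · exact hy

lemma nextState_of_le (h : Merging A) (r : ℕ) {y x : ℝ} (hy : y ∈ Set.Icc (0 : ℝ) (5 / 6))
    (hx : x ∈ Set.Icc (5 / 6 : ℝ) 1) : nextState (A r) y x = 1 - x :=
  if_pos (h.high r y hy x hx)

lemma gain_of_le (h : Merging A) (r : ℕ) {y x : ℝ} (hy : y ∈ Set.Icc (0 : ℝ) (5 / 6))
    (hx : x ∈ Set.Icc (5 / 6 : ℝ) 1) : gain (A r) y x = 1 :=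
  if_pos (h.high r y hy x hx)

end Merging

lemma abs_integral_unif_le {f : ℝ → ℝ} {c : ℝ} {s : Set ℝ} (hs : MeasurableSet s) {d δ : ℝ}
    (hd : 0 ≤ d) (hδ : unif.real s ≤ δ)
    (h : ∀ x ∈ Set.Icc (0 : ℝ) 1,
      |f x| ≤ (Set.Ico (0 : ℝ) (5 / 6)).indicator (fun _ => c) x + s.indicator (fun _ => d) x) :
    |∫ x, f x ∂unif| ≤ 5 / 6 * c + δ * d := by
  have i1 : Integrable ((Set.Ico (0 : ℝ) (5 / 6)).indicator (fun _ => c)) unif :=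
    (integrable_const _).indicator measurableSet_Ico
  have i2 : Integrable (s.indicator (fun _ => d)) unif := (integrable_const _).indicator hs
  have h1 := norm_integral_le_of_norm_le (μ := unif) (f := f) (i1.add i2) (by
    filter_upwards [unif_ae_mem] with x hx using h x hx)
  rw [Real.norm_eq_abs] at h1
  refine h1.trans ?_
  simp only [Pi.add_apply]
  rw [integral_add i1 i2, integral_unif_indicator_Ico_const c le_rfl (by norm_num) (by norm_num),
    integral_indicator_const _ hs, smul_eq_mul, sub_zero]
  gcongr

/-- With probability `1/6` the observation is at least `5/6` and makes both states equal; otherwise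
the gap grows by at most `1`. The bound `5` is the fixed point of `c ↦ 5/6 * (c + 1)`. -/
lemma Merging.abs_runValue_sub_le {A : ℕ → Set (ℝ × ℝ)} (h : Merging A) (r : ℕ) {y y' : ℝ}
    (hy : y ∈ Set.Icc (0 : ℝ) (5 / 6)) (hy' : y' ∈ Set.Icc (0 : ℝ) (5 / 6)) :
    |runValue A r y - runValue A r y'| ≤ 5 := by
  induction r generalizing y y' with
  | zero => simp [runValue]
  | succ r ih =>
    rw [runValue, runValue, ← integral_sub (integrable_stepValue h.meas r y)
      (integrable_stepValue h.meas r y')]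
    refine (abs_integral_unif_le (c := 6) (d := 0) (δ := 0) MeasurableSet.empty le_rfl
      (by simp) fun x hx => ?_).trans (by norm_num)
    simp only [Set.indicator_empty, add_zero]
    rcases lt_or_ge x (5 / 6) with hx6 | hx6
    · rw [Set.indicator_of_mem (show x ∈ Set.Ico (0 : ℝ) (5 / 6) from ⟨hx.1, hx6⟩)]
      have h1 := ih (h.nextState_mem r hy hx) (h.nextState_mem r hy' hx)
      have := gain_nonneg (A r) y x
      have := gain_nonneg (A r) y' x
      have := gain_le_one (A r) y x
      have := gain_le_one (A r) y' x
      rw [abs_le] at h1 ⊢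
      constructor <;> linarith
    · rw [h.nextState_of_le r hy ⟨hx6, hx.2⟩, h.nextState_of_le r hy' ⟨hx6, hx.2⟩,
        h.gain_of_le r hy ⟨hx6, hx.2⟩, h.gain_of_le r hy' ⟨hx6, hx.2⟩, sub_self, abs_zero,
        Set.indicator_of_notMem (fun hm => (hm.2.trans_le hx6).false)]

/-- Two sequences of acceptance regions that agree except for observations in small sets. -/
structure Coupled (A B : ℕ → Set (ℝ × ℝ)) (bad : ℕ → Set ℝ) (ε : ℕ → ℝ) : Prop where
  left : Merging A
  right : Merging B
  meas : ∀ r, MeasurableSet (bad r)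
  agree : ∀ r, ∀ y ∈ Set.Icc (0 : ℝ) (5 / 6), ∀ x ∈ Set.Icc (0 : ℝ) 1, x ∉ bad r →
    ((y, x) ∈ A r ↔ (y, x) ∈ B r)
  small : ∀ r, unif.real (bad r) ≤ ε r

/-- A bound for the oscillation of the difference of the two value functions. -/
def oscBound (ε : ℕ → ℝ) : ℕ → ℝ
  | 0 => 0
  | r + 1 => 5 / 6 * oscBound ε r + ε r * 12

lemma sum_oscBound (ε : ℕ → ℝ) (n : ℕ) :
    ∑ r ∈ Finset.range n, oscBound ε r + 6 * oscBound ε n = 72 * ∑ r ∈ Finset.range n, ε r := by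
  induction n with
  | zero => simp [oscBound]
  | succ n ih =>
    rw [Finset.sum_range_succ, Finset.sum_range_succ, oscBound]
    linarith

lemma oscBound_nonneg {ε : ℕ → ℝ} (h : ∀ r, 0 ≤ ε r) (r : ℕ) : 0 ≤ oscBound ε r := by
  induction r with
  | zero => simp [oscBound]
  | succ r ih =>
    rw [oscBound]
    have := h r
    positivity

/-- The difference of the numbers of selections from now on, up to one step ahead. -/
def stepDiff (A B : ℕ → Set (ℝ × ℝ)) (r : ℕ) (y y' x : ℝ) : ℝ :=
  (gain (A r) y x + runValue A r (nextState (A r) y x)) -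
    (gain (B r) y' x + runValue B r (nextState (B r) y' x))

namespace Coupled
variable {A B : ℕ → Set (ℝ × ℝ)} {bad : ℕ → Set ℝ} {ε : ℕ → ℝ}

lemma nonneg (h : Coupled A B bad ε) (r : ℕ) : 0 ≤ ε r := measureReal_nonneg.trans (h.small r)

lemma nextState_eq (h : Coupled A B bad ε) (r : ℕ) {y x : ℝ} (hy : y ∈ Set.Icc (0 : ℝ) (5 / 6))
    (hx : x ∈ Set.Icc (0 : ℝ) 1) (hb : x ∉ bad r) :
    nextState (B r) y x = nextState (A r) y x ∧ gain (B r) y x = gain (A r) y x := by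
  have hi := h.agree r y hy x hx hb
  by_cases hA : (y, x) ∈ A r
  · simp [nextState, gain, hA, hi.1 hA]
  · have hB : (y, x) ∉ B r := fun hB => hA (hi.2 hB)
    simp [nextState, gain, hA, hB]

lemma abs_stepDiff_sub_le (h : Coupled A B bad ε) (r : ℕ) {y₁ y₂ y x : ℝ}
    (hy₁ : y₁ ∈ Set.Icc (0 : ℝ) (5 / 6)) (hy₂ : y₂ ∈ Set.Icc (0 : ℝ) (5 / 6))
    (hy : y ∈ Set.Icc (0 : ℝ) (5 / 6)) (hx : x ∈ Set.Icc (0 : ℝ) 1) :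
    |stepDiff A B r y₁ y₂ x - (runValue A r y - runValue B r y)| ≤ 11 := by
  have h1 := h.left.abs_runValue_sub_le r (h.left.nextState_mem r hy₁ hx) hy
  have h2 := h.right.abs_runValue_sub_le r (h.right.nextState_mem r hy₂ hx) hy
  have := gain_nonneg (A r) y₁ x
  have := gain_nonneg (B r) y₂ x
  have := gain_le_one (A r) y₁ x
  have := gain_le_one (B r) y₂ x
  unfold stepDiff
  rw [abs_le] at h1 h2 ⊢
  constructor <;> linarith

lemma stepDiff_of_notMem (h : Coupled A B bad ε) (r : ℕ) {y x : ℝ}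
    (hy : y ∈ Set.Icc (0 : ℝ) (5 / 6)) (hx : x ∈ Set.Icc (0 : ℝ) 1) (hb : x ∉ bad r) :
    stepDiff A B r y y x =
      runValue A r (nextState (A r) y x) - runValue B r (nextState (A r) y x) := by
  obtain ⟨h1, h2⟩ := h.nextState_eq r hy hx hb
  rw [stepDiff, h1, h2]
  ring

lemma integrable_stepDiff (h : Coupled A B bad ε) (r : ℕ) (y y' : ℝ) :
    Integrable (stepDiff A B r y y') unif :=
  (integrable_stepValue h.left.meas r y).sub (integrable_stepValue h.right.meas r y')

lemma integral_stepDiff (h : Coupled A B bad ε) (r : ℕ) (y y' : ℝ) :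
    ∫ x, stepDiff A B r y y' x ∂unif = runValue A (r + 1) y - runValue B (r + 1) y' :=
  integral_sub (integrable_stepValue h.left.meas r y) (integrable_stepValue h.right.meas r y')

/-- Off the bad set both rules act alike, so the old oscillation persists only when `x < 5/6`. On
the bad set it is at most `12 = 5 + 5 + 1 + 1`, from the two value gaps and the two gains. -/
lemma abs_sub_le_oscBound (h : Coupled A B bad ε) (r : ℕ) {y y' : ℝ}
    (hy : y ∈ Set.Icc (0 : ℝ) (5 / 6)) (hy' : y' ∈ Set.Icc (0 : ℝ) (5 / 6)) :
    |(runValue A r y - runValue B r y) - (runValue A r y' - runValue B r y')| ≤ oscBound ε r := by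
  induction r generalizing y y' with
  | zero => simp [runValue, oscBound]
  | succ r ih =>
    rw [← h.integral_stepDiff, ← h.integral_stepDiff,
      ← integral_sub (h.integrable_stepDiff r y y) (h.integrable_stepDiff r y' y')]
    rw [oscBound]
    have ho := oscBound_nonneg h.nonneg r
    have key : ∀ x ∈ Set.Icc (0 : ℝ) 1, |stepDiff A B r y y x - stepDiff A B r y' y' x| ≤ 12 := by
      intro x hx
      have h1 := h.left.abs_runValue_sub_le r (h.left.nextState_mem r hy hx)
        (h.left.nextState_mem r hy' hx)
      have h2 := h.right.abs_runValue_sub_le r (h.right.nextState_mem r hy hx)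
        (h.right.nextState_mem r hy' hx)
      have h3 : |gain (A r) y x - gain (A r) y' x| ≤ 1 := by
        rw [abs_le]
        constructor <;> linarith [gain_nonneg (A r) y x, gain_nonneg (A r) y' x,
          gain_le_one (A r) y x, gain_le_one (A r) y' x]
      have h4 : |gain (B r) y x - gain (B r) y' x| ≤ 1 := by
        rw [abs_le]
        constructor <;> linarith [gain_nonneg (B r) y x, gain_nonneg (B r) y' x,
          gain_le_one (B r) y x, gain_le_one (B r) y' x]
      unfold stepDiff
      rw [abs_le] at h1 h2 h3 h4 ⊢
      constructor <;> linarith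
    refine abs_integral_unif_le (h.meas r) (by norm_num) (h.small r) fun x hx => ?_
    by_cases hb : x ∈ bad r
    · rw [Set.indicator_of_mem hb]
      have := key x hx
      have : 0 ≤ (Set.Ico (0 : ℝ) (5 / 6)).indicator (fun _ => oscBound ε r) x :=
        Set.indicator_nonneg (fun _ _ => ho) x
      linarith
    · rw [Set.indicator_of_notMem hb, h.stepDiff_of_notMem r hy hx hb,
        h.stepDiff_of_notMem r hy' hx hb, add_zero]
      rcases lt_or_ge x (5 / 6) with hx6 | hx6
      · rw [Set.indicator_of_mem (show x ∈ Set.Ico (0 : ℝ) (5 / 6) from ⟨hx.1, hx6⟩)]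
        exact ih (h.left.nextState_mem r hy hx) (h.left.nextState_mem r hy' hx)
      · rw [h.left.nextState_of_le r hy ⟨hx6, hx.2⟩, h.left.nextState_of_le r hy' ⟨hx6, hx.2⟩,
          sub_self, abs_zero]
        exact Set.indicator_nonneg (fun _ _ => ho) x

end Coupled

open Classical in
/-- The indicator of two states being different. -/
def apart (y y' : ℝ) : ℝ := if y = y' then 0 else 1

lemma apart_nonneg (y y' : ℝ) : 0 ≤ apart y y' := by unfold apart; split_ifs <;> norm_num

lemma apart_le_one (y y' : ℝ) : apart y y' ≤ 1 := by unfold apart; split_ifs <;> norm_num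

lemma measurable_apart : Measurable fun p : ℝ × ℝ => apart p.1 p.2 :=
  Measurable.ite (measurableSet_eq_fun measurable_fst measurable_snd) measurable_const
    measurable_const

/-- The mean square of a shifted centered variable is at most the square of the shift plus the
mean square deviation from any constant. -/
lemma integral_sq_add_sub_integral_le {α : Type*} [MeasurableSpace α] {ρ : Measure α}
    [IsProbabilityMeasure ρ] {f : α → ℝ} (hf : Integrable f ρ)
    (hf2 : ∀ c, Integrable (fun x => (f x - c) ^ 2) ρ) (a c : ℝ) :
    ∫ x, (a + f x - ∫ t, f t ∂ρ) ^ 2 ∂ρ ≤ a ^ 2 + ∫ x, (f x - c) ^ 2 ∂ρ := by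
  set H := ∫ t, f t ∂ρ with hH
  have h1 : ∀ x, (a + f x - H) ^ 2 =
      (f x - c) ^ 2 + (2 * (a + c - H) * (f x - c) + (a + c - H) ^ 2) := by intro x; ring
  simp only [h1]
  have i1 : Integrable (fun x => f x - c) ρ := hf.sub (integrable_const _)
  have i2 : Integrable (fun x => 2 * (a + c - H) * (f x - c)) ρ := i1.const_mul _
  have i3 : Integrable (fun x => 2 * (a + c - H) * (f x - c) + (a + c - H) ^ 2) ρ :=
    i2.add (integrable_const _)
  rw [integral_add (hf2 c) i3, integral_add i2 (integrable_const _), integral_const_mul,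
    integral_sub hf (integrable_const _), ← hH]
  simp only [integral_const, probReal_univ, one_smul]
  nlinarith [sq_nonneg (H - c)]

namespace Coupled
variable {A B : ℕ → Set (ℝ × ℝ)} {bad : ℕ → Set ℝ} {ε : ℕ → ℝ}

lemma measurable_stepDiff (h : Coupled A B bad ε) (r : ℕ) :
    Measurable fun p : (ℝ × ℝ) × ℝ => stepDiff A B r p.1.1 p.1.2 p.2 :=
  ((measurable_stepValue h.left.meas r).comp
    ((measurable_fst.comp measurable_fst).prodMk measurable_snd)).sub
  ((measurable_stepValue h.right.meas r).comp
    ((measurable_snd.comp measurable_fst).prodMk measurable_snd))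

lemma abs_stepDiff_le (A B : ℕ → Set (ℝ × ℝ)) (r : ℕ) (y y' x : ℝ) :
    |stepDiff A B r y y' x| ≤ 2 * (r + 1) := by
  refine (abs_sub _ _).trans ?_
  linarith [abs_stepValue_le A r y x, abs_stepValue_le B r y' x]

lemma integrable_sq_stepDiff_sub (h : Coupled A B bad ε) (r : ℕ) (y y' c : ℝ) :
    Integrable (fun x => (stepDiff A B r y y' x - c) ^ 2) unif := by
  have hm : Measurable fun x => stepDiff A B r y y' x :=
    (h.measurable_stepDiff r).comp
      ((measurable_const (a := (y, y'))).prodMk measurable_id)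
  refine integrable_of_bounded ((hm.sub_const c).pow_const 2) ((2 * (r + 1) + |c|) ^ 2) fun x => ?_
  rw [abs_pow]
  refine pow_le_pow_left₀ (abs_nonneg _) ((abs_sub _ _).trans ?_) 2
  linarith [abs_stepDiff_le A B r y y' x]

/-- One step of the second moment recursion. -/
lemma integral_step_le (h : Coupled A B bad ε) (r : ℕ) {y y' : ℝ} (a : ℝ)
    (hy : y ∈ Set.Icc (0 : ℝ) (5 / 6)) (hy' : y' ∈ Set.Icc (0 : ℝ) (5 / 6)) :
    ∫ x, ((a + stepDiff A B r y y' x - (runValue A (r + 1) y - runValue B (r + 1) y')) ^ 2 +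
      726 * apart (nextState (A r) y x) (nextState (B r) y' x)) ∂unif ≤
    a ^ 2 + 726 * apart y y' + (10 * oscBound ε r + 847 * ε r) := by
  have h0 : (0 : ℝ) ∈ Set.Icc (0 : ℝ) (5 / 6) := by norm_num
  have iap : Integrable (fun x => apart (nextState (A r) y x) (nextState (B r) y' x)) unif := by
    refine integrable_of_bounded (measurable_apart.comp
      (((measurable_nextState (h.left.meas r)).comp measurable_prodMk_left).prodMk
        ((measurable_nextState (h.right.meas r)).comp measurable_prodMk_left))) 1 fun x => ?_
    rw [abs_of_nonneg (apart_nonneg _ _)]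
    exact apart_le_one _ _
  have isq : Integrable (fun x => (a + stepDiff A B r y y' x -
      (runValue A (r + 1) y - runValue B (r + 1) y')) ^ 2) unif := by
    refine (h.integrable_sq_stepDiff_sub r y y'
      ((runValue A (r + 1) y - runValue B (r + 1) y') - a)).congr
      (Eventually.of_forall fun x => ?_)
    ring
  rw [integral_add isq (iap.const_mul _), integral_const_mul, ← h.integral_stepDiff]
  -- The variance of a step is at most the mean square deviation from any constant; the value
  -- difference at the reference state `0` is close to all others.
  set c := runValue A r 0 - runValue B r 0 with hc
  have hsq := integral_sq_add_sub_integral_le (h.integrable_stepDiff r y y')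
    (h.integrable_sq_stepDiff_sub r y y') a c
  by_cases hyy : y = y'
  · subst hyy
    have ibad : ∀ d : ℝ, Integrable ((bad r).indicator (fun _ => d)) unif := fun d =>
      (integrable_const _).indicator (h.meas r)
    have ebad : ∀ d : ℝ, 0 ≤ d → ∫ x, (bad r).indicator (fun _ => d) x ∂unif ≤ ε r * d := by
      intro d hd
      rw [integral_indicator_const _ (h.meas r), smul_eq_mul]
      exact mul_le_mul_of_nonneg_right (h.small r) hd
    have ho := oscBound_nonneg h.nonneg r
    -- Off the bad set the deviation is bounded both by `10` and by the oscillation, hence its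
    -- square by their product; on the bad set `11 ^ 2 = 121`. A new separation of the states later
    -- costs `726 * ε r`, and `121 + 726 = 847`.
    have e1 : ∫ x, (stepDiff A B r y y x - c) ^ 2 ∂unif ≤ 10 * oscBound ε r + ε r * 121 := by
      have : ∫ x, (stepDiff A B r y y x - c) ^ 2 ∂unif ≤
          ∫ x, (10 * oscBound ε r + (bad r).indicator (fun _ => (121 : ℝ)) x) ∂unif := by
        refine integral_mono_ae (h.integrable_sq_stepDiff_sub r y y c)
          ((integrable_const _).add (ibad _)) ?_
        filter_upwards [unif_ae_mem] with x hx
        rw [← sq_abs]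
        by_cases hb : x ∈ bad r
        · rw [Set.indicator_of_mem hb]
          have := h.abs_stepDiff_sub_le r hy hy h0 hx
          have := abs_nonneg (stepDiff A B r y y x - c)
          nlinarith
        · rw [Set.indicator_of_notMem hb, h.stepDiff_of_notMem r hy hx hb]
          have hn := h.left.nextState_mem r hy hx
          have h1 := h.abs_sub_le_oscBound r hn h0
          have h2 := h.left.abs_runValue_sub_le r hn h0
          have h3 := h.right.abs_runValue_sub_le r hn h0
          have h4 : |runValue A r (nextState (A r) y x) - runValue B r (nextState (A r) y x) - c|
              ≤ 10 := by
            rw [hc]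
            rw [abs_le] at h2 h3 ⊢
            constructor <;> linarith
          rw [sq, add_zero]
          exact mul_le_mul h4 h1 (abs_nonneg _) (by norm_num)
      refine this.trans ?_
      rw [integral_add (integrable_const _) (ibad _)]
      simp only [integral_const, probReal_univ, one_smul]
      linarith [ebad 121 (by norm_num)]
    have e2 : ∫ x, apart (nextState (A r) y x) (nextState (B r) y x) ∂unif ≤ ε r * 1 := by
      refine le_trans (integral_mono_ae iap (ibad 1) ?_) (ebad 1 zero_le_one)
      filter_upwards [unif_ae_mem] with x hx
      by_cases hb : x ∈ bad r
      · rw [Set.indicator_of_mem hb]; exact apart_le_one _ _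
      · rw [Set.indicator_of_notMem hb, (h.nextState_eq r hy hx hb).1]
        simp [apart]
    have : apart y y = 0 := by simp [apart]
    rw [this]
    linarith
  -- Separated states merge with probability at least `1/6`, so the penalty drops in mean by at
  -- least `726 / 6 = 121`, which pays for the variance of this step.
  · have e1 : ∫ x, (stepDiff A B r y y' x - c) ^ 2 ∂unif ≤ 121 := by
      have : ∫ x, (stepDiff A B r y y' x - c) ^ 2 ∂unif ≤ ∫ _, (121 : ℝ) ∂unif := by
        refine integral_mono_ae (h.integrable_sq_stepDiff_sub r y y' c) (integrable_const _) ?_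
        filter_upwards [unif_ae_mem] with x hx
        rw [← sq_abs]
        have := h.abs_stepDiff_sub_le r hy hy' h0 hx
        have := abs_nonneg (stepDiff A B r y y' x - c)
        nlinarith
      simpa using this
    have e2 : ∫ x, apart (nextState (A r) y x) (nextState (B r) y' x) ∂unif ≤
        (5 / 6 - 0) * 1 := by
      rw [← integral_unif_indicator_Ico_const 1 le_rfl (by norm_num) (by norm_num)]
      refine integral_mono_ae iap ((integrable_const _).indicator measurableSet_Ico) ?_
      filter_upwards [unif_ae_mem] with x hx
      rcases lt_or_ge x (5 / 6) with hx6 | hx6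
      · rw [Set.indicator_of_mem (show x ∈ Set.Ico (0 : ℝ) (5 / 6) from ⟨hx.1, hx6⟩)]; exact apart_le_one _ _
      · rw [h.left.nextState_of_le r hy ⟨hx6, hx.2⟩, h.right.nextState_of_le r hy' ⟨hx6, hx.2⟩,
          Set.indicator_of_notMem (fun hm => (hm.2.trans_le hx6).false)]
        simp [apart]
    have : apart y y' = 1 := by simp [apart, hyy]
    rw [this]
    linarith [oscBound_nonneg h.nonneg r, h.nonneg r]

end Coupled

/-- The number of selections among the first `m` observations `x`. -/
def runCount (S : ℕ → Set (ℝ × ℝ)) (x : ℕ → ℝ) (m : ℕ) : ℝ :=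
  ∑ i ∈ Finset.range m, gain (S i) (runState S x i) (x i)

lemma runCount_succ (S : ℕ → Set (ℝ × ℝ)) (x : ℕ → ℝ) (m : ℕ) :
    runCount S x (m + 1) = runCount S x m + gain (S m) (runState S x m) (x m) :=
  Finset.sum_range_succ _ _

lemma runCount_mem (S : ℕ → Set (ℝ × ℝ)) (x : ℕ → ℝ) (m : ℕ) :
    runCount S x m ∈ Set.Icc (0 : ℝ) m := by
  induction m with
  | zero => simp [runCount]
  | succ m ih =>
    rw [runCount_succ]
    push_cast
    exact ⟨add_nonneg ih.1 (gain_nonneg _ _ _), add_le_add ih.2 (gain_le_one _ _ _)⟩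

lemma measurable_runState {Ω : Type*} (X : ℕ → Ω → ℝ) {S : ℕ → Set (ℝ × ℝ)}
    (hS : ∀ i, MeasurableSet (S i)) (i : ℕ) :
    Measurable[past X i] fun ω => runState S (fun j => X j ω) i := by
  induction i with
  | zero => exact measurable_const
  | succ i ih =>
    exact (measurable_nextState (hS i)).comp
      ((ih.mono (past_mono X i.le_succ) le_rfl).prodMk (measurable_past X i.lt_succ_self))

lemma measurable_runCount {Ω : Type*} (X : ℕ → Ω → ℝ) {S : ℕ → Set (ℝ × ℝ)}
    (hS : ∀ i, MeasurableSet (S i)) (i : ℕ) :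
    Measurable[past X i] fun ω => runCount S (fun j => X j ω) i := by
  induction i with
  | zero => simp only [runCount, Finset.range_zero, Finset.sum_empty]; exact measurable_const
  | succ i ih =>
    simp only [runCount_succ]
    exact (ih.mono (past_mono X i.le_succ) le_rfl).add ((measurable_gain (hS i)).comp
      (((measurable_runState X hS i).mono (past_mono X i.le_succ) le_rfl).prodMk
        (measurable_past X i.lt_succ_self)))

lemma Merging.runState_mem {A : ℕ → Set (ℝ × ℝ)} (h : Merging A) {x : ℕ → ℝ}
    (hx : ∀ i, x i ∈ Set.Icc (0 : ℝ) 1) (k : ℕ → ℕ) (i : ℕ) :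
    runState (fun i => A (k i)) x i ∈ Set.Icc (0 : ℝ) (5 / 6) := by
  induction i with
  | zero => simp only [runState]; norm_num
  | succ i ih => exact h.nextState_mem _ ih (hx i)

/-- The expected number of selections given the first `i` of `N` observations. -/
def condCount (A : ℕ → Set (ℝ × ℝ)) (N : ℕ) (x : ℕ → ℝ) (i : ℕ) : ℝ :=
  runCount (fun i => A (N - 1 - i)) x i +
    runValue A (N - i) (runState (fun i => A (N - 1 - i)) x i)

lemma abs_condCount_le (A : ℕ → Set (ℝ × ℝ)) {N i : ℕ} (hi : i ≤ N) (x : ℕ → ℝ) :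
    |condCount A N x i| ≤ N := by
  refine (abs_add_le _ _).trans ?_
  have h1 := runCount_mem (fun i => A (N - 1 - i)) x i
  have h2 := abs_runValue_le A (N - i) (runState (fun i => A (N - 1 - i)) x i)
  rw [abs_of_nonneg h1.1]
  push_cast [hi] at h2
  linarith [h1.2]

lemma measurable_condCount {Ω : Type*} (X : ℕ → Ω → ℝ) {A : ℕ → Set (ℝ × ℝ)}
    (hA : ∀ i, MeasurableSet (A i)) (N i : ℕ) :
    Measurable[past X i] fun ω => condCount A N (fun j => X j ω) i :=
  (measurable_runCount X (fun _ => hA _) i).add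
    ((measurable_runValue hA _).comp (measurable_runState X (fun _ => hA _) i))

lemma condCount_succ (A : ℕ → Set (ℝ × ℝ)) {N i : ℕ} (hi : i < N) (x : ℕ → ℝ) :
    condCount A N x (i + 1) = condCount A N x i +
      (gain (A (N - 1 - i)) (runState (fun i => A (N - 1 - i)) x i) (x i) +
        runValue A (N - 1 - i) (nextState (A (N - 1 - i))
          (runState (fun i => A (N - 1 - i)) x i) (x i))) -
      runValue A (N - 1 - i + 1) (runState (fun i => A (N - 1 - i)) x i) := by
  have h1 : N - (i + 1) = N - 1 - i := by omega
  have h2 : N - i = N - 1 - i + 1 := by omega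
  simp only [condCount, runCount_succ, h1, h2, runState]
  ring

/-! ### Second moment of the difference of two coupled counts -/

namespace Coupled
variable {A B : ℕ → Set (ℝ × ℝ)} {bad : ℕ → Set ℝ} {ε : ℕ → ℝ}

lemma measurable_step (h : Coupled A B bad ε) (r : ℕ) :
    Measurable fun p : (ℝ × (ℝ × ℝ)) × ℝ =>
      (p.1.1 + stepDiff A B r p.1.2.1 p.1.2.2 p.2 -
        (runValue A (r + 1) p.1.2.1 - runValue B (r + 1) p.1.2.2)) ^ 2 +
      726 * apart (nextState (A r) p.1.2.1 p.2) (nextState (B r) p.1.2.2 p.2) := by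
  have m1 : Measurable fun p : (ℝ × (ℝ × ℝ)) × ℝ => p.1.2.1 := by fun_prop
  have m2 : Measurable fun p : (ℝ × (ℝ × ℝ)) × ℝ => p.1.2.2 := by fun_prop
  have m3 : Measurable fun p : (ℝ × (ℝ × ℝ)) × ℝ => (p.1.2, p.2) := by fun_prop
  have s := (h.measurable_stepDiff r).comp m3
  have a := (measurable_runValue h.left.meas (r + 1)).comp m1
  have b := (measurable_runValue h.right.meas (r + 1)).comp m2
  have n1 := (measurable_nextState (h.left.meas r)).comp (m1.prodMk measurable_snd)
  have n2 := (measurable_nextState (h.right.meas r)).comp (m2.prodMk measurable_snd)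
  have ap := measurable_apart.comp (n1.prodMk n2)
  exact ((((measurable_fst.comp measurable_fst).add s).sub (a.sub b)).pow_const 2).add
    (ap.const_mul 726)

lemma integrable_sq_condCount (h : Coupled A B bad ε) {Ω : Type*} [MeasurableSpace Ω]
    {μ : Measure Ω} [IsProbabilityMeasure μ] {X : ℕ → Ω → ℝ} (hX : IsUniformSample μ X) {N i : ℕ}
    (hi : i ≤ N) :
    Integrable (fun ω => (condCount A N (fun j => X j ω) i - condCount B N (fun j => X j ω) i -
        (runValue A N 0 - runValue B N 0)) ^ 2 +
      726 * apart (runState (fun i => A (N - 1 - i)) (fun j => X j ω) i)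
        (runState (fun i => B (N - 1 - i)) (fun j => X j ω) i)) μ := by
  refine integrable_of_bounded ?_ ((4 * N) ^ 2 + 726 * 1) fun ω => ?_
  · refine Measurable.mono (ma := past X i) ?_ (past_le hX.measurable i) le_rfl
    exact (((measurable_condCount X h.left.meas N i).sub
      (measurable_condCount X h.right.meas N i)).sub_const _ |>.pow_const 2).add
      ((measurable_apart.comp ((measurable_runState X (fun _ => h.left.meas _) i).prodMk
        (measurable_runState X (fun _ => h.right.meas _) i))).const_mul 726)
  · rw [abs_of_nonneg (add_nonneg (sq_nonneg _) (mul_nonneg (by norm_num) (apart_nonneg _ _)))]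
    refine add_le_add ?_ (mul_le_mul_of_nonneg_left (apart_le_one _ _) (by norm_num))
    have h1 := abs_le.1 (abs_condCount_le A hi (fun j => X j ω))
    have h2 := abs_le.1 (abs_condCount_le B hi (fun j => X j ω))
    have h3 := abs_le.1 (abs_runValue_le A N 0)
    have h4 := abs_le.1 (abs_runValue_le B N 0)
    exact sq_le_sq' (by linarith) (by linarith)

/-- The conditional expectations form a martingale started at zero, and the states agree initially.
Each step is the one-step bound integrated over the past. -/
theorem integral_sq_condCount_le (h : Coupled A B bad ε) {Ω : Type*} [MeasurableSpace Ω]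
    {μ : Measure Ω} [IsProbabilityMeasure μ] {X : ℕ → Ω → ℝ} (hX : IsUniformSample μ X) (N : ℕ)
    {i : ℕ} (hi : i ≤ N) :
    ∫ ω, ((condCount A N (fun j => X j ω) i - condCount B N (fun j => X j ω) i -
        (runValue A N 0 - runValue B N 0)) ^ 2 +
      726 * apart (runState (fun i => A (N - 1 - i)) (fun j => X j ω) i)
        (runState (fun i => B (N - 1 - i)) (fun j => X j ω) i)) ∂μ ≤
    ∑ j ∈ Finset.range i, (10 * oscBound ε (N - 1 - j) + 847 * ε (N - 1 - j)) := by
  have hint := fun i (hi : i ≤ N) => h.integrable_sq_condCount hX hi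
  induction i with
  | zero => simp [condCount, runCount, runState, apart]
  | succ i ih =>
    have hi' : i < N := hi
    rw [Finset.sum_range_succ]
    set r := N - 1 - i with hr
    set SA : Ω → ℝ := fun ω => runState (fun i => A (N - 1 - i)) (fun j => X j ω) i with hSA
    set SB : Ω → ℝ := fun ω => runState (fun i => B (N - 1 - i)) (fun j => X j ω) i with hSB
    set M : Ω → ℝ := fun ω => condCount A N (fun j => X j ω) i - condCount B N (fun j => X j ω) i -
        (runValue A N 0 - runValue B N 0) with hM
    have hSm : Measurable[past X i] fun ω => (M ω, (SA ω, SB ω)) :=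
      (((measurable_condCount X h.left.meas N i).sub
        (measurable_condCount X h.right.meas N i)).sub_const _).prodMk
        ((measurable_runState X (fun _ => h.left.meas _) i).prodMk
          (measurable_runState X (fun _ => h.right.meas _) i))
    have heq : ∀ ω, (condCount A N (fun j => X j ω) (i + 1) -
        condCount B N (fun j => X j ω) (i + 1) - (runValue A N 0 - runValue B N 0)) ^ 2 +
        726 * apart (runState (fun i => A (N - 1 - i)) (fun j => X j ω) (i + 1))
        (runState (fun i => B (N - 1 - i)) (fun j => X j ω) (i + 1)) =
        (M ω + stepDiff A B r (SA ω) (SB ω) (X i ω) -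
        (runValue A (r + 1) (SA ω) - runValue B (r + 1) (SB ω))) ^ 2 +
        726 * apart (nextState (A r) (SA ω) (X i ω)) (nextState (B r) (SB ω) (X i ω)) := by
      intro ω
      rw [condCount_succ A hi', condCount_succ B hi']
      simp only [hM, stepDiff, runState, ← hr, hSA, hSB]
      congr 2
      ring
    have hint1 := hint (i + 1) hi
    have hint0 := hint i hi'.le
    simp only [heq] at hint1 ⊢
    have key := integral_comp_indep_le (past_le hX.measurable i) hSm (hX.measurable i)
      (hX.indep_past i) (hX.law i) (h.measurable_step r) hint1
      (ψ := fun ω => (M ω ^ 2 + 726 * apart (SA ω) (SB ω)) + (10 * oscBound ε r + 847 * ε r))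
      (hint0.add (integrable_const _)) (by
        filter_upwards [hX.ae_mem] with ω hω
        exact h.integral_step_le r (M ω) (h.left.runState_mem hω _ i)
          (h.right.runState_mem hω _ i))
    refine key.trans ?_
    rw [integral_add hint0 (integrable_const _)]
    simp only [integral_const, probReal_univ, one_smul]
    exact add_le_add (ih hi'.le) le_rfl

/-- At the horizon no value remains, so the martingale is the count difference minus a constant. The
constant is `1567 = 10 * 72 + 847`, where `72` comes from summing `oscBound`. -/
theorem variance_runCount_sub_le (h : Coupled A B bad ε) {Ω : Type*} [MeasurableSpace Ω]
    {μ : Measure Ω} [IsProbabilityMeasure μ] {X : ℕ → Ω → ℝ} (hX : IsUniformSample μ X) (N : ℕ) :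
    ∫ ω, (runCount (fun i => A (N - 1 - i)) (fun j => X j ω) N -
        runCount (fun i => B (N - 1 - i)) (fun j => X j ω) N -
        (runValue A N 0 - runValue B N 0)) ^ 2 ∂μ ≤
    1567 * ∑ r ∈ Finset.range N, ε r := by
  have h1 := h.integral_sq_condCount_le hX N le_rfl
  have h2 := Finset.sum_range_reflect (fun r => 10 * oscBound ε r + 847 * ε r) N
  rw [h2, Finset.sum_add_distrib, ← Finset.mul_sum, ← Finset.mul_sum] at h1
  have h3 := sum_oscBound ε N
  have h4 := oscBound_nonneg h.nonneg N
  refine le_trans ?_ (h1.trans (by linarith))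
  refine integral_mono_of_nonneg (Eventually.of_forall fun ω => sq_nonneg _) ?_
    (Eventually.of_forall fun ω => ?_)
  · exact h.integrable_sq_condCount hX le_rfl
  · have := apart_nonneg (runState (fun i => A (N - 1 - i)) (fun j => X j ω) N)
        (runState (fun i => B (N - 1 - i)) (fun j => X j ω) N)
    simp only [condCount, Nat.sub_self, runValue, add_zero]
    linarith

end Coupled

/-! ### The `L²` estimate -/

lemma nextState_mem_Icc (A : Set (ℝ × ℝ)) {y x : ℝ} (hy : y ∈ Set.Icc (0 : ℝ) 1)
    (hx : x ∈ Set.Icc (0 : ℝ) 1) : nextState A y x ∈ Set.Icc (0 : ℝ) 1 := by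
  unfold nextState
  split_ifs
  · exact one_sub_mem_Icc hx
  · exact hy

lemma runState_mem_Icc (S : ℕ → Set (ℝ × ℝ)) {x : ℕ → ℝ} (hx : ∀ i, x i ∈ Set.Icc (0 : ℝ) 1)
    (i : ℕ) : runState S x i ∈ Set.Icc (0 : ℝ) 1 := by
  induction i with
  | zero => simp [runState]
  | succ i ih => exact nextState_mem_Icc _ ih (hx i)

lemma thresholdState_eq_runState {h : ℕ → ℝ → ℝ} {S : ℕ → Set (ℝ × ℝ)} {x : ℕ → ℝ}
    (hx : ∀ i, x i ∈ Set.Icc (0 : ℝ) 1) {N : ℕ}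
    (hS : ∀ i < N, ∀ y ∈ Set.Icc (0 : ℝ) 1, ∀ x ∈ Set.Icc (0 : ℝ) 1, h i y ≤ x ↔ (y, x) ∈ S i)
    {i : ℕ} (hi : i ≤ N) : thresholdState h x i = runState S x i := by
  induction i with
  | zero => rfl
  | succ i ih =>
    have ih := ih (Nat.le_of_succ_le hi)
    have := hS i hi _ (runState_mem_Icc S hx i) _ (hx i)
    rw [thresholdState, runState, nextState, ih]
    by_cases hm : (runState S x i, x i) ∈ S i
    · rw [if_pos hm, if_neg (not_lt.2 (this.2 hm))]
    · rw [if_neg hm, if_pos (not_le.1 (this.not.2 hm))]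

lemma thresholdCount_eq_runCount {h : ℕ → ℝ → ℝ} {S : ℕ → Set (ℝ × ℝ)} {x : ℕ → ℝ}
    (hx : ∀ i, x i ∈ Set.Icc (0 : ℝ) 1) {N : ℕ}
    (hS : ∀ i < N, ∀ y ∈ Set.Icc (0 : ℝ) 1, ∀ x ∈ Set.Icc (0 : ℝ) 1, h i y ≤ x ↔ (y, x) ∈ S i)
    {m : ℕ} (hm : m ≤ N) : (thresholdCount h x m : ℝ) = runCount S x m := by
  rw [thresholdCount, runCount, Nat.cast_sum]
  refine Finset.sum_congr rfl fun i hi => ?_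
  have hi' : i < N := (Finset.mem_range.1 hi).trans_le hm
  have := hS i hi' _ (runState_mem_Icc S hx i) _ (hx i)
  rw [thresholdState_eq_runState hx hS hi'.le, gain]
  by_cases hm : (runState S x i, x i) ∈ S i
  · simp [hm, this.2 hm]
  · simp only [hm, this.not.2 hm, if_false, Nat.cast_zero]

/-- The acceptance region of the optimal policy before the last `k` observations. -/
def optRegion (k : ℕ) : Set (ℝ × ℝ) := {p | Accept (valueFn k) p.1 p.2}

/-- The acceptance region of the limiting policy. -/
def limRegion : Set (ℝ × ℝ) := {p | max xiLimit p.1 ≤ p.2}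

lemma measurableSet_optRegion (k : ℕ) : MeasurableSet (optRegion k) := by
  have hc := continuous_valueFn k
  exact ((isClosed_le continuous_fst continuous_snd).and
    (isClosed_le (by fun_prop) (by fun_prop))).measurableSet

lemma measurableSet_limRegion : MeasurableSet limRegion :=
  (isClosed_le (by fun_prop) (by fun_prop)).measurableSet

lemma mem_Icc_one {y : ℝ} (hy : y ∈ Set.Icc (0 : ℝ) (5 / 6)) : y ∈ Set.Icc (0 : ℝ) 1 :=
  ⟨hy.1, hy.2.trans (by norm_num)⟩

/-- Below `ξ_{r+3}` both rules reject, and above `ξ + oscBelow (r + 2)` both accept exactly when `y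
≤ x`. The shift by `2` omits the last two observations, since confinement to `[0,5/6]` relies on the
fixed point being at least `1/6`. -/
lemma coupled_optRegion_limRegion : Coupled (fun r => optRegion (r + 2)) (fun _ => limRegion)
    (fun r => Set.Icc (minFixedPoint (r + 3)) (xiLimit + oscBelow (r + 2)))
    (fun r => xiLimit - minFixedPoint (r + 3) + oscBelow (r + 2)) where
  left :=
    { meas := fun r => measurableSet_optRegion _
      low := fun r y hy x hx h => (one_sixth_le_minFixedPoint (by omega)).trans
        (Accept.minFixedPoint_le (mem_Icc_one hy) hx h)
      high := fun r y hy x hx => accept_of_half_le _ (mem_Icc_one hy) hx.2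
        (by linarith [hx.1]) (hy.2.trans hx.1) }
  right :=
    { meas := fun r => measurableSet_limRegion
      low := fun r y hy x hx h => (one_sixth_le_minFixedPoint le_rfl).trans
        ((minFixedPoint_le_xiLimit 2).trans ((le_max_left _ _).trans h))
      high := fun r y hy x hx =>
        max_le (xiLimit_le_half.trans (by linarith [hx.1])) (hy.2.trans hx.1) }
  meas := fun r => measurableSet_Icc
  agree := by
    intro r y hy x hx hb
    have hξ := minFixedPoint_le_xiLimit (r + 2)
    have ho := oscBelow_nonneg (r + 2)
    rcases lt_or_ge x (minFixedPoint (r + 3)) with h | h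
    · refine iff_of_false (fun hA => ?_) (fun hB => ?_)
      · exact absurd (Accept.minFixedPoint_le (mem_Icc_one hy) hx hA) (not_le.2 h)
      · have h1 : xiLimit ≤ x := (le_max_left _ _).trans hB
        exact absurd (hξ.trans h1) (not_le.2 h)
    · have h2 : xiLimit + oscBelow (r + 2) < x := by
        by_contra! hc
        exact hb ⟨h, hc⟩
      constructor
      · intro hA
        exact max_le (by linarith) hA.1
      · intro hB
        exact accept_of_minFixedPoint_add_le _ (mem_Icc_one hy) hx ((le_max_right _ _).trans hB)
          (by linarith)
  small := fun r => (unif_real_Icc_le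
    (by linarith [minFixedPoint_le_xiLimit (r + 2), oscBelow_nonneg (r + 2)])).trans
      (by linarith)

lemma optimalCount_eq_runCount {x : ℕ → ℝ} (hx : ∀ i, x i ∈ Set.Icc (0 : ℝ) 1) {n m : ℕ}
    (hm : m ≤ n) :
    (optimalCount n x m : ℝ) = runCount (fun i => optRegion (n - 1 - i)) x m := by
  refine thresholdCount_eq_runCount hx (N := n) (fun i hi y hy x hx => ?_) hm
  have : n - i = n - 1 - i + 1 := by omega
  rw [this]
  exact threshold_le_iff _ hy hx

lemma limitCount_eq_runCount {x : ℕ → ℝ} (hx : ∀ i, x i ∈ Set.Icc (0 : ℝ) 1) (m : ℕ) :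
    (limitCount x m : ℝ) = runCount (fun _ => limRegion) x m :=
  thresholdCount_eq_runCount hx (N := m) (fun _ _ _ _ _ _ => Iff.rfl) le_rfl

lemma runCount_congr {S S' : ℕ → Set (ℝ × ℝ)} {m : ℕ} (h : ∀ i < m, S i = S' i) (x : ℕ → ℝ) :
    runCount S x m = runCount S' x m := by
  have hs : ∀ i ≤ m, runState S x i = runState S' x i := by
    intro i
    induction i with
    | zero => intro _; rfl
    | succ i ih => intro hi; rw [runState, runState, ih (by omega), h i (by omega)]
  refine Finset.sum_congr rfl fun i hi => ?_
  rw [Finset.mem_range] at hi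
  rw [hs i hi.le, h i hi]

/-- The constant in the `L²` estimate. -/
def l2Const : ℝ := 1567 * (1 + 2 / (xiLimit - minFixedPoint 3))

/-- The oscillations contribute at most `2`, while the sum of `ξ - ξ_k` already contains the
positive term `ξ - ξ_3`. -/
lemma sum_error_le {n : ℕ} (hn : 3 ≤ n) :
    1567 * ∑ r ∈ Finset.range (n - 2), (xiLimit - minFixedPoint (r + 3) + oscBelow (r + 2)) ≤
      l2Const * ∑ k ∈ Finset.Icc 3 n, (xiLimit - minFixedPoint k) := by
  have hpos : 0 < xiLimit - minFixedPoint 3 := sub_pos.2 minFixedPoint_three_lt_xiLimit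
  have h1 : ∑ k ∈ Finset.Icc 3 n, (xiLimit - minFixedPoint k) =
      ∑ r ∈ Finset.range (n - 2), (xiLimit - minFixedPoint (r + 3)) := by
    have : Finset.Icc 3 n = Finset.Ico 3 (n + 1) := by ext; simp
    rw [this, Finset.sum_Ico_eq_sum_range, show n + 1 - 3 = n - 2 by omega]
    exact Finset.sum_congr rfl fun r _ => by rw [add_comm]
  have h2 : ∑ r ∈ Finset.range (n - 2), oscBelow (r + 2) ≤ 2 := by
    refine le_trans ?_ (sum_oscBelow_le n)
    have := Finset.sum_range_add_sum_Ico oscBelow (show 2 ≤ n by omega)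
    rw [Finset.sum_Ico_eq_sum_range] at this
    have h3 : ∑ r ∈ Finset.range (n - 2), oscBelow (r + 2) =
        ∑ r ∈ Finset.range (n - 2), oscBelow (2 + r) :=
      Finset.sum_congr rfl fun r _ => by rw [add_comm]
    have h4 : 0 ≤ ∑ r ∈ Finset.range 2, oscBelow r :=
      Finset.sum_nonneg fun r _ => oscBelow_nonneg r
    linarith
  have h3 : xiLimit - minFixedPoint 3 ≤
      ∑ r ∈ Finset.range (n - 2), (xiLimit - minFixedPoint (r + 3)) :=
    Finset.single_le_sum (f := fun r => xiLimit - minFixedPoint (r + 3))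
      (fun r _ => sub_nonneg.2 (minFixedPoint_le_xiLimit (r + 2)))
      (Finset.mem_range.2 (by omega : 0 < n - 2))
  rw [h1, Finset.sum_add_distrib, l2Const, mul_assoc]
  refine mul_le_mul_of_nonneg_left ?_ (by norm_num)
  rw [add_mul, one_mul]
  have h4 : 2 ≤ 2 / (xiLimit - minFixedPoint 3) *
      ∑ r ∈ Finset.range (n - 2), (xiLimit - minFixedPoint (r + 3)) := by
    rw [div_mul_eq_mul_div, le_div_iff₀ hpos]
    linarith
  linarith

section Estimate
variable {Ω : Type*} [MeasurableSpace Ω] {μ : Measure Ω} [IsProbabilityMeasure μ]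
  {X : ℕ → Ω → ℝ}

lemma integrable_runCount (hX : IsUniformSample μ X) {S : ℕ → Set (ℝ × ℝ)}
    (hS : ∀ i, MeasurableSet (S i)) (m : ℕ) :
    Integrable (fun ω => runCount S (fun j => X j ω) m) μ := by
  refine integrable_of_bounded
    ((measurable_runCount X hS m).mono (past_le hX.measurable m) le_rfl) m fun ω => ?_
  have := runCount_mem S (fun j => X j ω) m
  rw [abs_of_nonneg this.1]
  exact this.2

theorem memLp_centeredDiff (hX : IsUniformSample μ X) {n : ℕ} (hn : 3 ≤ n) :
    MemLp (centeredDiff μ X n) 2 μ ∧ lpNorm (centeredDiff μ X n) 2 μ ^ 2 ≤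
      l2Const * ∑ k ∈ Finset.Icc 3 n, (xiLimit - minFixedPoint k) := by
  set N := n - 2 with hN
  set a : Ω → ℝ := fun ω => runCount (fun i => optRegion (N - 1 - i + 2)) (fun j => X j ω) N
  set b : Ω → ℝ := fun ω => runCount (fun _ => limRegion) (fun j => X j ω) N
  have ia : Integrable a μ := integrable_runCount hX (fun _ => measurableSet_optRegion _) N
  have ib : Integrable b μ := integrable_runCount hX (fun _ => measurableSet_limRegion) N
  have ha : (fun ω => (optimalCount n (fun i => X i ω) N : ℝ)) =ᵐ[μ] a := by
    filter_upwards [hX.ae_mem] with ω hω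
    rw [optimalCount_eq_runCount hω (by omega)]
    refine runCount_congr (fun i hi => ?_) _
    congr 1
    omega
  have hb : (fun ω => (limitCount (fun i => X i ω) N : ℝ)) =ᵐ[μ] b := by
    filter_upwards [hX.ae_mem] with ω hω
    exact limitCount_eq_runCount hω N
  set W : Ω → ℝ := fun ω => a ω - b ω with hW
  have iW : Integrable W μ := ia.sub ib
  have hWm : Measurable W :=
    ((measurable_runCount X (fun _ => measurableSet_optRegion _) N).mono
      (past_le hX.measurable N) le_rfl).sub
    ((measurable_runCount X (fun _ => measurableSet_limRegion) N).mono
      (past_le hX.measurable N) le_rfl)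
  have hWb : ∀ ω, |W ω| ≤ N := by
    intro ω
    have h1 := runCount_mem (fun i => optRegion (N - 1 - i + 2)) (fun j => X j ω) N
    have h2 := runCount_mem (fun _ => limRegion) (fun j => X j ω) N
    rw [abs_le]
    constructor <;> simp only [hW, a, b] <;> linarith [h1.1, h1.2, h2.1, h2.2]
  have hc : centeredDiff μ X n =ᵐ[μ] fun ω => W ω - ∫ ω', W ω' ∂μ := by
    filter_upwards [ha, hb] with ω h1 h2
    rw [centeredDiff, ← hN, integral_congr_ae ha, integral_congr_ae hb, hW,
      integral_sub ia ib, h1, h2]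
    ring
  have isq : ∀ c, Integrable (fun ω => (W ω - c) ^ 2) μ := by
    intro c
    refine integrable_of_bounded ((hWm.sub_const c).pow_const 2) ((N + |c|) ^ 2) fun ω => ?_
    rw [abs_pow]
    exact pow_le_pow_left₀ (abs_nonneg _) ((abs_sub _ _).trans (by linarith [hWb ω])) 2
  have hmem : MemLp (fun ω => W ω - ∫ ω', W ω' ∂μ) 2 μ :=
    (memLp_two_iff_integrable_sq (hWm.sub_const _).aestronglyMeasurable).2 (isq _)
  have hmem' : MemLp (centeredDiff μ X n) 2 μ := (memLp_congr_ae hc).2 hmem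
  refine ⟨hmem', ?_⟩
  have hnorm : lpNorm (centeredDiff μ X n) 2 μ ^ 2 = ∫ ω, (W ω - ∫ ω', W ω' ∂μ) ^ 2 ∂μ := by
    rw [lpNorm_eq_integral_norm_rpow_toReal (by norm_num) (by norm_num) hmem'.1]
    rw [← Real.rpow_natCast, ← Real.rpow_mul (integral_nonneg fun ω => by positivity)]
    norm_num
    refine integral_congr_ae ?_
    filter_upwards [hc] with ω h
    rw [h]
  rw [hnorm]
  -- The variance is the least mean square deviation, so the initial value difference need not be
  -- identified with the mean.
  have h1 := integral_sq_add_sub_integral_le iW isq 0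
    (runValue (fun r => optRegion (r + 2)) N 0 - runValue (fun _ => limRegion) N 0)
  have h2 := coupled_optRegion_limRegion.variance_runCount_sub_le hX N
  simp only [zero_add, ne_eq, OfNat.ofNat_ne_zero, not_false_eq_true, zero_pow] at h1
  exact h1.trans (h2.trans (sum_error_le hn))

end Estimate

lemma isLittleO_sum_sub_minFixedPoint :
    (fun n : ℕ => ∑ k ∈ Finset.Icc 3 n, (xiLimit - minFixedPoint k)) =o[atTop]
      fun n : ℕ => (n : ℝ) := by
  have h0 : Tendsto (fun k => |xiLimit - minFixedPoint k|) atTop (𝓝 0) := by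
    have := (tendsto_const_nhds (x := xiLimit)).sub tendsto_minFixedPoint
    simpa using this.abs
  have h1 := h0.cesaro
  rw [isLittleO_iff]
  intro c hc
  have h2 := (tendsto_add_atTop_iff_nat 1).2 h1
  filter_upwards [h2.eventually_lt_const (show (0 : ℝ) < c / 2 by positivity),
    eventually_ge_atTop 1] with n hn hn1
  have hpos : (0 : ℝ) < ((n + 1 : ℕ) : ℝ) := by positivity
  rw [inv_mul_lt_iff₀ hpos] at hn
  have h3 : |∑ k ∈ Finset.Icc 3 n, (xiLimit - minFixedPoint k)| ≤
      ∑ k ∈ Finset.range (n + 1), |xiLimit - minFixedPoint k| := by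
    refine (Finset.abs_sum_le_sum_abs _ _).trans ?_
    refine Finset.sum_le_sum_of_subset_of_nonneg ?_ fun _ _ _ => abs_nonneg _
    intro k hk
    rw [Finset.mem_Icc] at hk
    exact Finset.mem_range.2 (by omega)
  rw [Real.norm_eq_abs, Real.norm_of_nonneg (Nat.cast_nonneg n)]
  have h4 : (1 : ℝ) ≤ n := by exact_mod_cast hn1
  push_cast at hn
  nlinarith

theorem isLittleO_lpNorm_centeredDiff {Ω : Type*} [MeasurableSpace Ω] {μ : Measure Ω}
    [IsProbabilityMeasure μ] {X : ℕ → Ω → ℝ} (hX : IsUniformSample μ X) :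
    (fun n : ℕ => lpNorm (centeredDiff μ X n) 2 μ) =o[atTop] fun n : ℕ => Real.sqrt n := by
  rw [isLittleO_iff]
  intro c hc
  have h := (isLittleO_sum_sub_minFixedPoint.const_mul_left l2Const)
  rw [isLittleO_iff] at h
  filter_upwards [h (show (0 : ℝ) < c ^ 2 by positivity), eventually_ge_atTop 3] with n hn hn3
  have h1 := (memLp_centeredDiff hX hn3).2
  rw [Real.norm_of_nonneg lpNorm_nonneg, Real.norm_of_nonneg (Real.sqrt_nonneg _)]
  refine le_of_sq_le_sq ?_ (by positivity)
  rw [mul_pow, Real.sq_sqrt (Nat.cast_nonneg n)]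
  rw [Real.norm_of_nonneg (Nat.cast_nonneg n)] at hn
  exact h1.trans ((le_abs_self _).trans hn)

/-! ### Reflected observations -/

section Reflection
variable {Ω : Type*} {m : MeasurableSpace Ω} [mΩ : MeasurableSpace Ω] {μ : Measure Ω}

open Classical in
/-- Reflecting a uniform variable on an independent event keeps its law and the independence. -/
lemma measure_inter_reflect [IsProbabilityMeasure μ] (hm : m ≤ mΩ) {T : Ω → ℝ} (hT : Measurable T)
    (hi : Indep m (MeasurableSpace.comap T inferInstance) μ) (hl : μ.map T = unif) {E : Set Ω}
    (hE : MeasurableSet[m] E) {A : Set Ω} (hA : MeasurableSet[m] A) {B : Set ℝ}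
    (hB : MeasurableSet B) :
    μ (A ∩ (fun ω => if ω ∈ E then 1 - T ω else T ω) ⁻¹' B) = μ A * unif B := by
  have hr1 : Measurable fun x : ℝ => 1 - x := by fun_prop
  have hB' : MeasurableSet ((fun x : ℝ => 1 - x) ⁻¹' B) := hr1 hB
  have key : ∀ C : Set ℝ, MeasurableSet C → ∀ D, MeasurableSet[m] D →
      μ (D ∩ T ⁻¹' C) = μ D * unif C := by
    intro C hC D hD
    rw [(Indep_iff _ _ _).1 hi D (T ⁻¹' C) hD ⟨C, hC, rfl⟩, ← hl, Measure.map_apply hT hC]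
  have hr : unif ((fun x : ℝ => 1 - x) ⁻¹' B) = unif B := by
    rw [← Measure.map_apply hr1 hB, map_one_sub_unif]
  rw [← measure_inter_add_sdiff _ (hm _ hE)]
  have e1 : A ∩ (fun ω => if ω ∈ E then 1 - T ω else T ω) ⁻¹' B ∩ E =
      A ∩ E ∩ T ⁻¹' ((fun x : ℝ => 1 - x) ⁻¹' B) := by
    ext ω
    by_cases h : ω ∈ E <;> simp [h]
  have e2 : (A ∩ (fun ω => if ω ∈ E then 1 - T ω else T ω) ⁻¹' B) \ E =
      (A \ E) ∩ T ⁻¹' B := by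
    ext ω
    by_cases h : ω ∈ E <;> simp [h]
  rw [e1, e2, key _ hB' _ (hA.inter hE), key _ hB _ (hA.diff hE), hr, ← add_mul,
    measure_inter_add_sdiff _ (hm _ hE)]

/-- Induction on the largest index of a finite set: the other events belong to its past. -/
lemma iIndepFun_of_indep_past [IsProbabilityMeasure μ] {X : ℕ → Ω → ℝ}
    (h : ∀ i, Indep (past X i) (MeasurableSpace.comap (X i) inferInstance) μ) :
    iIndepFun X μ := by
  rw [iIndepFun_iff_measure_inter_preimage_eq_mul]
  intro S
  induction S using Finset.induction_on_max with
  | empty => intro sets _; simp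
  | insert a s ha ih =>
    intro sets H
    have hns : a ∉ s := fun hm => lt_irrefl _ (ha a hm)
    have hmeas : MeasurableSet[past X a] (⋂ i ∈ s, X i ⁻¹' sets i) :=
      MeasurableSet.biInter s.countable_toSet fun i hi =>
        measurable_past X (ha i hi) (H i (Finset.mem_insert_of_mem hi))
    rw [Finset.set_biInter_insert, Finset.prod_insert hns, Set.inter_comm,
      (Indep_iff _ _ _).1 (h a) _ _ hmeas ⟨sets a, H a (Finset.mem_insert_self a s), rfl⟩,
      ih fun i hi => H i (Finset.mem_insert_of_mem hi), mul_comm]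

end Reflection

/-! ### Selections described by counts -/

/-- The numbers `N i` of selections among the first `i` observations of a non-anticipating
selection rule. -/
structure IsCounting {Ω : Type*} (U : ℕ → Ω → ℝ) (N : ℕ → Ω → ℕ) : Prop where
  zero : ∀ ω, N 0 ω = 0
  step : ∀ i ω, N (i + 1) ω = N i ω ∨ N (i + 1) ω = N i ω + 1
  meas : ∀ i, Measurable[past U i] (N i)

/-- The reflected observations: an observation that has to be smaller than the last selected one
is reflected. -/
def redObs {Ω : Type*} (U : ℕ → Ω → ℝ) (N : ℕ → Ω → ℕ) (i : ℕ) (ω : Ω) : ℝ :=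
  if Even (N i ω) then 1 - U i ω else U i ω

/-- The state that belongs to the reflected observations. -/
def redState {Ω : Type*} (U : ℕ → Ω → ℝ) (N : ℕ → Ω → ℕ) : ℕ → Ω → ℝ
  | 0, _ => 0
  | i + 1, ω => if N (i + 1) ω = N i ω then redState U N i ω else 1 - redObs U N i ω

/-- Every selection but the first exceeds the state. -/
def Admissible {Ω : Type*} (U : ℕ → Ω → ℝ) (N : ℕ → Ω → ℕ) : Prop :=
  ∀ i ω, N (i + 1) ω = N i ω + 1 → N i ω = 0 ∨ redState U N i ω < redObs U N i ω

namespace IsCounting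
variable {Ω : Type*} {U : ℕ → Ω → ℝ} {N : ℕ → Ω → ℕ}

lemma mono (h : IsCounting U N) (ω : Ω) : Monotone fun i => N i ω :=
  monotone_nat_of_le_succ fun i => by rcases h.step i ω with e | e <;> omega

lemma le (h : IsCounting U N) (i : ℕ) (ω : Ω) : N i ω ≤ i := by
  induction i with
  | zero => exact (h.zero ω).le
  | succ i ih => rcases h.step i ω with e | e <;> omega

lemma redState_of_eq_zero (h : IsCounting U N) {i : ℕ} {ω : Ω} (h0 : N i ω = 0) :
    redState U N i ω = 0 := by
  induction i with
  | zero => rfl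
  | succ i ih =>
    have : N i ω ≤ N (i + 1) ω := h.mono ω i.le_succ
    have hi : N i ω = 0 := by omega
    rw [redState, if_pos (by omega), ih hi]

lemma redState_eq_of_eq (h : IsCounting U N) {i i' : ℕ} {ω : Ω} (hi : i ≤ i')
    (he : N i' ω = N i ω) : redState U N i' ω = redState U N i ω := by
  induction i', hi using Nat.le_induction with
  | base => rfl
  | succ k hk ih =>
    have h1 : N i ω ≤ N k ω := h.mono ω hk
    have h2 : N k ω ≤ N (k + 1) ω := h.mono ω k.le_succ
    rw [redState, if_pos (by omega), ih (by omega)]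

lemma measurable_even (h : IsCounting U N) (i : ℕ) :
    MeasurableSet[past U i] {ω | Even (N i ω)} :=
  h.meas i (t := {k : ℕ | Even k}) trivial

lemma measurable_redObs (h : IsCounting U N) (i : ℕ) :
    Measurable[past U (i + 1)] (redObs U N i) :=
  Measurable.ite (past_mono U i.le_succ _ (h.measurable_even i))
    (measurable_const.sub (measurable_past U i.lt_succ_self)) (measurable_past U i.lt_succ_self)

lemma measurable_redState (h : IsCounting U N) (i : ℕ) :
    Measurable[past U i] (redState U N i) := by
  induction i with
  | zero => exact measurable_const
  | succ i ih =>
    have h1 : Measurable[past U (i + 1)] (N i) := (h.meas i).mono (past_mono U i.le_succ) le_rfl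
    exact Measurable.ite (measurableSet_eq_fun (h.meas (i + 1)) h1)
      (ih.mono (past_mono U i.le_succ) le_rfl) (measurable_const.sub (h.measurable_redObs i))

/-! ### The loss in one step -/

/-- The expected number of selections when optimal decisions follow the first `i` ones. -/
def potential (U : ℕ → Ω → ℝ) (N : ℕ → Ω → ℕ) (n i : ℕ) (ω : Ω) : ℝ :=
  N i ω + valueFn (n - i) (redState U N i ω)

/-- The loss caused by the decision on the observation with the number `i`. -/
def loss (U : ℕ → Ω → ℝ) (N : ℕ → Ω → ℕ) (n i : ℕ) (ω : Ω) : ℝ :=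
  N i ω + bellman (valueFn (n - 1 - i)) (redState U N i ω) (redObs U N i ω) -
    (N (i + 1) ω + valueFn (n - 1 - i) (redState U N (i + 1) ω))

lemma redState_le_redObs (h : IsCounting U N) (ha : Admissible U N) {i : ℕ} {ω : Ω}
    (hx : 0 ≤ redObs U N i ω) (hs : N (i + 1) ω = N i ω + 1) :
    redState U N i ω ≤ redObs U N i ω := by
  rcases ha i ω hs with h0 | h0
  · rw [h.redState_of_eq_zero h0]
    exact hx
  · exact h0.le

lemma loss_of_select {n i : ℕ} {ω : Ω} (hs : N (i + 1) ω = N i ω + 1)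
    (hle : redState U N i ω ≤ redObs U N i ω) :
    loss U N n i ω = max (valueFn (n - 1 - i) (redState U N i ω))
      (1 + valueFn (n - 1 - i) (1 - redObs U N i ω)) -
        (1 + valueFn (n - 1 - i) (1 - redObs U N i ω)) := by
  rw [loss, redState, if_neg (by omega), bellman, if_pos hle, hs]
  push_cast
  ring

lemma loss_of_skip {n i : ℕ} {ω : Ω} (hs : N (i + 1) ω = N i ω) :
    loss U N n i ω = bellman (valueFn (n - 1 - i)) (redState U N i ω) (redObs U N i ω) -
      valueFn (n - 1 - i) (redState U N i ω) := by
  rw [loss, redState, if_pos hs, hs]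
  ring

/-! ### Law of the reflected sample and the total expected loss -/

section Law
variable [MeasurableSpace Ω] {μ : Measure Ω}

lemma redObs_measurable (h : IsCounting U N) (hU : IsUniformSample μ U) (i : ℕ) :
    Measurable (redObs U N i) :=
  (h.measurable_redObs i).mono (past_le hU.measurable _) le_rfl

variable [IsProbabilityMeasure μ]

lemma measure_inter_redObs (h : IsCounting U N) (hU : IsUniformSample μ U) (i : ℕ) {A : Set Ω}
    (hA : MeasurableSet[past U i] A) {B : Set ℝ} (hB : MeasurableSet B) :
    μ (A ∩ redObs U N i ⁻¹' B) = μ A * unif B := by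
  have := measure_inter_reflect (past_le hU.measurable i) (hU.measurable i) (hU.indep_past i)
    (hU.law i) (h.measurable_even i) hA hB
  convert this using 3
  ext ω
  by_cases he : Even (N i ω) <;> simp [redObs, he]

lemma redObs_law (h : IsCounting U N) (hU : IsUniformSample μ U) (i : ℕ) :
    μ.map (redObs U N i) = unif := by
  ext B hB
  rw [Measure.map_apply (h.redObs_measurable hU i) hB]
  simpa using h.measure_inter_redObs hU i MeasurableSet.univ hB

lemma indep_redObs (h : IsCounting U N) (hU : IsUniformSample μ U) (i : ℕ) :
    Indep (past U i) (MeasurableSpace.comap (redObs U N i) inferInstance) μ := by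
  rw [Indep_iff]
  rintro A _ hA ⟨B, hB, rfl⟩
  rw [h.measure_inter_redObs hU i hA hB, ← h.redObs_law hU i,
    Measure.map_apply (h.redObs_measurable hU i) hB]

/-- The parity of the count is known before the observation, and the uniform law is symmetric. Each
reflected observation is thus uniform and independent of the whole past of `U`, which contains the
earlier reflected observations. -/
lemma isUniformSample_redObs (h : IsCounting U N) (hU : IsUniformSample μ U) :
    IsUniformSample μ (redObs U N) where
  measurable := h.redObs_measurable hU
  law := h.redObs_law hU
  indep := by
    refine iIndepFun_of_indep_past fun i => ?_
    refine indep_of_indep_of_le_left (h.indep_redObs hU i) (iSup₂_le fun j hj => ?_)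
    exact ((h.measurable_redObs j).mono (past_mono U hj) le_rfl).comap_le

lemma ae_mem (h : IsCounting U N) (hU : IsUniformSample μ U) :
    ∀ᵐ ω ∂μ, ∀ i, redObs U N i ω ∈ Set.Icc (0 : ℝ) 1 ∧ redState U N i ω ∈ Set.Icc (0 : ℝ) 1 := by
  filter_upwards [(h.isUniformSample_redObs hU).ae_mem] with ω hω i
  refine ⟨hω i, ?_⟩
  induction i with
  | zero => simp [redState]
  | succ i ih =>
    rw [redState]
    split_ifs
    · exact ih
    · exact one_sub_mem_Icc (hω i)

/-- Almost surely, an observation avoids a set that contains at most one point for each state. -/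
lemma ae_notMem (h : IsCounting U N) (hU : IsUniformSample μ U) (i : ℕ) {E : Set (ℝ × ℝ)}
    (hE : MeasurableSet E) (hs : ∀ y, {x | (y, x) ∈ E}.Subsingleton) :
    ∀ᵐ ω ∂μ, (redState U N i ω, redObs U N i ω) ∉ E := by
  have hS := h.measurable_redState i
  have hm : Measurable fun ω => (redState U N i ω, redObs U N i ω) :=
    (hS.mono (past_le hU.measurable i) le_rfl).prodMk (h.redObs_measurable hU i)
  have hφ : Measurable (E.indicator fun _ => (1 : ℝ)) := measurable_const.indicator hE
  have hint : Integrable (fun ω => E.indicator (fun _ => (1 : ℝ))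
      (redState U N i ω, redObs U N i ω)) μ := by
    refine integrable_of_bounded (hφ.comp hm) 1 fun ω => ?_
    by_cases hw : (redState U N i ω, redObs U N i ω) ∈ E <;> simp [hw]
  have h1 := (integral_comp_indep (past_le hU.measurable i) hS (h.redObs_measurable hU i)
    (h.indep_redObs hU i) (h.redObs_law hU i) hφ hint).2
  have h2 : ∀ y, ∫ x, E.indicator (fun _ => (1 : ℝ)) (y, x) ∂unif = 0 := by
    intro y
    refine integral_eq_zero_of_ae ?_
    have : unif {x | (y, x) ∈ E} = 0 := (hs y).measure_zero unif
    filter_upwards [measure_eq_zero_iff_ae_notMem.1 this] with x hx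
    exact Set.indicator_of_notMem (by exact hx) _
  simp only [h2, integral_zero] at h1
  rw [integral_eq_zero_iff_of_nonneg (fun ω => Set.indicator_nonneg (by simp) _) hint] at h1
  filter_upwards [h1] with ω hω hmem
  simp [hmem] at hω

lemma abs_valueFn_le (k : ℕ) {y : ℝ} (hy : y ∈ Set.Icc (0 : ℝ) 1) :
    |valueFn k y| ≤ |valueFn k 0| + |valueFn k 1| := by
  have h1 := antitoneOn_valueFn k (Set.left_mem_Icc.2 zero_le_one) hy hy.1
  have h2 := antitoneOn_valueFn k hy (Set.right_mem_Icc.2 zero_le_one) hy.2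
  rw [abs_le]
  constructor <;> linarith [le_abs_self (valueFn k 0), neg_abs_le (valueFn k 1),
    abs_nonneg (valueFn k 0), abs_nonneg (valueFn k 1)]

lemma integrable_count (h : IsCounting U N) (hU : IsUniformSample μ U) (i : ℕ) :
    Integrable (fun ω => (N i ω : ℝ)) μ := by
  refine integrable_of_bounded
    (measurable_from_top.comp ((h.meas i).mono (past_le hU.measurable i) le_rfl)) i fun ω => ?_
  rw [abs_of_nonneg (Nat.cast_nonneg _)]
  exact_mod_cast h.le i ω

lemma integrable_valueFn_redState (h : IsCounting U N) (hU : IsUniformSample μ U) (k i : ℕ) :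
    Integrable (fun ω => valueFn k (redState U N i ω)) μ := by
  refine Integrable.of_bound ((continuous_valueFn k).measurable.comp
    ((h.measurable_redState i).mono (past_le hU.measurable i) le_rfl)).aestronglyMeasurable
    (|valueFn k 0| + |valueFn k 1|) ?_
  filter_upwards [h.ae_mem hU] with ω hω
  exact abs_valueFn_le k (hω i).2

lemma measurable_bellman (k : ℕ) : Measurable fun p : ℝ × ℝ => bellman (valueFn k) p.1 p.2 := by
  have hc := (continuous_valueFn k).measurable
  exact Measurable.ite (measurableSet_le measurable_fst measurable_snd) (by fun_prop) (by fun_prop)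

lemma integrable_bellman_redState (h : IsCounting U N) (hU : IsUniformSample μ U) (k i : ℕ) :
    Integrable (fun ω => bellman (valueFn k) (redState U N i ω) (redObs U N i ω)) μ := by
  refine Integrable.of_bound ((measurable_bellman k).comp
    (((h.measurable_redState i).mono (past_le hU.measurable i) le_rfl).prodMk
      (h.redObs_measurable hU i))).aestronglyMeasurable
    (1 + (|valueFn k 0| + |valueFn k 1|)) ?_
  filter_upwards [h.ae_mem hU] with ω hω
  have h1 := abs_le.1 (abs_valueFn_le k (hω i).2)
  have h2 := abs_le.1 (abs_valueFn_le k (one_sub_mem_Icc (hω i).1))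
  rw [Real.norm_eq_abs, bellman, abs_le]
  split_ifs
  · refine ⟨le_max_of_le_left (by linarith), max_le (by linarith) (by linarith)⟩
  · constructor <;> linarith

/-- The state depends on the past and the reflected observation is fresh, so averaging over the
latter is one step of the Bellman recursion. -/
lemma integral_bellman_redState (h : IsCounting U N) (hU : IsUniformSample μ U) (k i : ℕ) :
    ∫ ω, bellman (valueFn k) (redState U N i ω) (redObs U N i ω) ∂μ =
      ∫ ω, valueFn (k + 1) (redState U N i ω) ∂μ := by
  rw [(integral_comp_indep (past_le hU.measurable i) (h.measurable_redState i)
    (h.redObs_measurable hU i) (h.indep_redObs hU i) (h.redObs_law hU i) (measurable_bellman k)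
    (h.integrable_bellman_redState hU k i)).2]
  refine integral_congr_ae ?_
  filter_upwards [h.ae_mem hU] with ω hω
  exact (valueFn_succ_eq_integral k (hω i).2).symm

lemma integrable_loss (h : IsCounting U N) (hU : IsUniformSample μ U) (n i : ℕ) :
    Integrable (loss U N n i) μ :=
  ((h.integrable_count hU i).add (h.integrable_bellman_redState hU _ i)).sub
    ((h.integrable_count hU (i + 1)).add (h.integrable_valueFn_redState hU _ (i + 1)))

lemma integral_loss (h : IsCounting U N) (hU : IsUniformSample μ U) {n i : ℕ} (hi : i < n) :
    ∫ ω, loss U N n i ω ∂μ = ∫ ω, potential U N n i ω ∂μ - ∫ ω, potential U N n (i + 1) ω ∂μ := by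
  have e1 : n - i = n - 1 - i + 1 := by omega
  have e2 : n - (i + 1) = n - 1 - i := by omega
  have i1 := h.integrable_count hU i
  have i2 := h.integrable_bellman_redState hU (n - 1 - i) i
  have i3 := h.integrable_count hU (i + 1)
  have i4 := h.integrable_valueFn_redState hU (n - 1 - i) (i + 1)
  have i5 := h.integrable_valueFn_redState hU (n - 1 - i + 1) i
  simp only [loss, potential, e1, e2]
  have i12 : Integrable (fun ω => (N i ω : ℝ) +
      bellman (valueFn (n - 1 - i)) (redState U N i ω) (redObs U N i ω)) μ := i1.add i2
  have i34 : Integrable (fun ω => (N (i + 1) ω : ℝ) +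
      valueFn (n - 1 - i) (redState U N (i + 1) ω)) μ := i3.add i4
  rw [integral_sub i12 i34, integral_add i1 i2, integral_add i1 i5,
    h.integral_bellman_redState hU]

/-- The expected losses are the decrements of the expected potential, which starts at `v_n 0` and
ends at the expected count. -/
lemma sum_integral_loss (h : IsCounting U N) (hU : IsUniformSample μ U) (n : ℕ) :
    ∑ i ∈ Finset.range n, ∫ ω, loss U N n i ω ∂μ = valueFn n 0 - ∫ ω, (N n ω : ℝ) ∂μ := by
  rw [Finset.sum_congr rfl fun i hi => h.integral_loss hU (Finset.mem_range.1 hi),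
    Finset.sum_range_sub']
  simp [potential, redState, h.zero, valueFn]

lemma loss_nonneg (h : IsCounting U N) (hU : IsUniformSample μ U) (ha : Admissible U N) (n i : ℕ) :
    0 ≤ᵐ[μ] loss U N n i := by
  filter_upwards [h.ae_mem hU] with ω hω
  rcases h.step i ω with hs | hs
  · rw [loss_of_skip hs]
    exact sub_nonneg.2 (le_bellman _ _ _)
  · rw [loss_of_select hs (h.redState_le_redObs ha (hω i).1.1 hs)]
    exact sub_nonneg.2 (le_max_right _ _)

theorem integral_count_le (h : IsCounting U N) (hU : IsUniformSample μ U) (ha : Admissible U N)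
    (n : ℕ) : ∫ ω, (N n ω : ℝ) ∂μ ≤ valueFn n 0 := by
  have h1 : 0 ≤ ∑ i ∈ Finset.range n, ∫ ω, loss U N n i ω ∂μ :=
    Finset.sum_nonneg fun i _ => integral_nonneg_of_ae (h.loss_nonneg hU ha n i)
  rw [h.sum_integral_loss hU n] at h1
  linarith

/-- An optimal selection rule accepts exactly the observations in the acceptance regions. -/
lemma ae_select_iff (h : IsCounting U N) (hU : IsUniformSample μ U) (ha : Admissible U N) {n : ℕ}
    (hopt : ∫ ω, (N n ω : ℝ) ∂μ = valueFn n 0) {i : ℕ} (hi : i < n) :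
    ∀ᵐ ω ∂μ, N (i + 1) ω = N i ω + 1 ↔
      (redState U N i ω, redObs U N i ω) ∈ optRegion (n - 1 - i) := by
  have h1 := h.sum_integral_loss hU n
  rw [hopt, sub_self, Finset.sum_eq_zero_iff_of_nonneg fun i _ =>
    integral_nonneg_of_ae (h.loss_nonneg hU ha n i)] at h1
  have h2 := h1 i (Finset.mem_range.2 hi)
  rw [integral_eq_zero_iff_of_nonneg_ae (h.loss_nonneg hU ha n i) (h.integrable_loss hU n i)] at h2
  set k := n - 1 - i with hk
  have hc := continuous_valueFn k
  -- Ties between selecting and skipping are null: for `k = 0` they would read `0 = 1`, and for `k ≥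
  -- 1` strict monotonicity leaves at most one such observation per state.
  have h3 := h.ae_notMem hU i (E := {p : ℝ × ℝ | p.2 ∈ Set.Icc (0 : ℝ) 1 ∧
      valueFn k p.1 = 1 + valueFn k (1 - p.2)})
    (((isClosed_Icc.preimage continuous_snd).and
      (isClosed_eq (by fun_prop) (by fun_prop))).measurableSet) (by
      rintro y x ⟨hx, hxe⟩ x' ⟨hx', hxe'⟩
      simp only at hx hxe hx' hxe'
      cases hkk : k with
      | zero => rw [hkk] at hxe; simp [valueFn] at hxe
      | succ k' =>
        rw [hkk] at hxe hxe'
        have := (strictAntiOn_valueFn k').injOn (one_sub_mem_Icc hx) (one_sub_mem_Icc hx')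
          (by linarith)
        linarith)
  filter_upwards [h2, h3, h.ae_mem hU] with ω hl hne hω
  rw [Pi.zero_apply] at hl
  rcases h.step i ω with hs | hs
  · refine iff_of_false (by omega) fun hacc => hne ⟨(hω i).1, ?_⟩
    rw [loss_of_skip hs, bellman, if_pos hacc.1] at hl
    exact le_antisymm hacc.2
      (by linarith [le_max_right (valueFn k (redState U N i ω)) (1 + valueFn k (1 - redObs U N i ω))])
  · refine iff_of_true hs ?_
    have hle := h.redState_le_redObs ha (hω i).1.1 hs
    rw [loss_of_select hs hle] at hl
    exact ⟨hle, by
      linarith [le_max_left (valueFn k (redState U N i ω)) (1 + valueFn k (1 - redObs U N i ω))]⟩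

theorem ae_count_eq (h : IsCounting U N) (hU : IsUniformSample μ U) (ha : Admissible U N) {n : ℕ}
    (hopt : ∫ ω, (N n ω : ℝ) ∂μ = valueFn n 0) :
    ∀ᵐ ω ∂μ, ∀ m ≤ n, N m ω = optimalCount n (fun i => redObs U N i ω) m := by
  have h1 : ∀ᵐ ω ∂μ, ∀ i, i < n → (N (i + 1) ω = N i ω + 1 ↔
      (redState U N i ω, redObs U N i ω) ∈ optRegion (n - 1 - i)) := by
    rw [ae_all_iff]
    intro i
    by_cases hi : i < n
    · filter_upwards [h.ae_select_iff hU ha hopt hi] with ω hω _ using hω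
    · exact Eventually.of_forall fun ω hi' => absurd hi' hi
  filter_upwards [h1, h.ae_mem hU] with ω hsel hω
  have key : ∀ m ≤ n,
      runState (fun i => optRegion (n - 1 - i)) (fun i => redObs U N i ω) m = redState U N m ω ∧
      runCount (fun i => optRegion (n - 1 - i)) (fun i => redObs U N i ω) m = N m ω := by
    intro m
    induction m with
    | zero => intro _; simp [runState, redState, runCount, h.zero]
    | succ m ih =>
      intro hm
      obtain ⟨e1, e2⟩ := ih (by omega)
      have hs := hsel m hm
      rw [runState, runCount_succ, e1, e2, redState, nextState, gain]
      rcases h.step m ω with hstep | hstep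
      · have hn : (redState U N m ω, redObs U N m ω) ∉ optRegion (n - 1 - m) :=
          hs.not.1 (by omega)
        simp [hn, hstep]
      · have hn := hs.1 hstep
        simp [hn, hstep]
  intro m hm
  have := optimalCount_eq_runCount (fun i => (hω i).1) hm
  rw [(key m hm).2] at this
  exact_mod_cast this.symm

end Law
end IsCounting

/-! ### Feasible policies and counts -/

section Policy
variable {Ω : Type*} {U : ℕ → Ω → ℝ} {n : ℕ} {θ : ℕ → Ω → WithTop ℕ}

lemma natCast_succ_le_of_lt {a : ℕ} {x : WithTop ℕ} (h : (a : WithTop ℕ) < x) :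
    ((a + 1 : ℕ) : WithTop ℕ) ≤ x := by
  cases x with
  | top => exact le_top
  | coe b => exact WithTop.coe_le_coe.2 (Nat.succ_le_of_lt (WithTop.coe_lt_coe.1 h))

lemma eq_top_or_exists_eq_natCast (x : WithTop ℕ) : x = ⊤ ∨ ∃ a : ℕ, x = (a : WithTop ℕ) := by
  cases x with
  | top => exact Or.inl rfl
  | coe a => exact Or.inr ⟨a, rfl⟩

namespace IsFeasible
variable [MeasurableSpace Ω] {hU : ∀ i, Measurable (U i)}

lemma monotone_apply (h : IsFeasible U hU n θ) (ω : Ω) : Monotone fun j => θ j ω :=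
  monotone_nat_of_le_succ fun j => h.monotone j ω

lemma le_apply (h : IsFeasible U hU n θ) (j : ℕ) (ω : Ω) : (j : WithTop ℕ) ≤ θ j ω := by
  induction j with
  | zero => exact zero_le
  | succ j ih =>
    by_cases ht : θ j ω = ⊤
    · have := h.monotone j ω
      rw [ht, top_le_iff] at this
      rw [this]
      exact le_top
    · have h1 := ih.trans_lt (h.strict j ω ht)
      exact natCast_succ_le_of_lt h1

/-- Selection times are monotone in `j`, so the counted indices form an initial segment. It is
finite because `θ j ≥ j`, hence `ncard` does not take its default value `0` for infinite sets. -/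
lemma lt_numSelections_iff (h : IsFeasible U hU n θ) (j i : ℕ) (ω : Ω) :
    j < numSelections θ i ω ↔ θ j ω < (i : WithTop ℕ) := by
  classical
  have hex : ∃ c, ¬ θ c ω < (i : WithTop ℕ) := ⟨i, not_lt.2 (h.le_apply i ω)⟩
  have hset : {j : ℕ | θ j ω < (i : WithTop ℕ)} = Set.Iio (Nat.find hex) := by
    ext j
    constructor
    · intro hj
      by_contra hc
      exact Nat.find_spec hex ((h.monotone_apply ω (not_lt.1 hc)).trans_lt hj)
    · intro hj
      exact not_not.1 (Nat.find_min hex hj)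
  have hc : numSelections θ i ω = Nat.find hex := by
    rw [numSelections, hset, ← Nat.card_coe_set_eq]
    simp
  rw [hc, ← Set.mem_Iio, ← hset]
  rfl

lemma isCounting (h : IsFeasible U hU n θ) : IsCounting U (numSelections θ) where
  zero ω := by
    by_contra hne
    have := (h.lt_numSelections_iff 0 0 ω).1 (Nat.pos_of_ne_zero hne)
    exact absurd this (by simp)
  step i ω := by
    have h1 : numSelections θ i ω ≤ numSelections θ (i + 1) ω := by
      by_contra! hlt
      have h2 := (h.lt_numSelections_iff _ i ω).1 hlt
      have h3 := (h.lt_numSelections_iff _ (i + 1) ω).2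
        (h2.trans (by exact_mod_cast i.lt_succ_self))
      exact lt_irrefl _ h3
    have h2 : numSelections θ (i + 1) ω ≤ numSelections θ i ω + 1 := by
      by_contra! hlt
      have h3 := (h.lt_numSelections_iff _ _ ω).1 hlt
      set c := numSelections θ i ω with hc
      have h4 : (i : WithTop ℕ) ≤ θ c ω :=
        not_lt.1 fun hh => lt_irrefl _ ((h.lt_numSelections_iff c i ω).2 hh)
      have h5 : θ c ω ≠ ⊤ := fun ht => by
        have := h.monotone c ω
        rw [ht, top_le_iff] at this
        rw [this] at h3
        exact absurd h3 (by simp)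
      exact absurd h3 (not_lt.2 (natCast_succ_le_of_lt (h4.trans_lt (h.strict c ω h5))))
    omega
  meas i := by
    refine measurable_of_Ioi fun j => ?_
    have : numSelections θ i ⁻¹' Set.Ioi j = {ω | θ j ω < (i : WithTop ℕ)} := by
      ext ω
      exact h.lt_numSelections_iff j i ω
    rw [this]
    cases i with
    | zero =>
      convert MeasurableSet.empty using 1
      ext ω
      simp
    | succ i =>
      have hs := h.stopping j i
      rw [obsFiltration_eq_past] at hs
      convert hs using 1
      ext ω
      change θ j ω < _ ↔ θ j ω ≤ _
      rcases eq_top_or_exists_eq_natCast (θ j ω) with hθ | ⟨a, hθ⟩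
      · simp [hθ]
      · rw [hθ]
        norm_cast
        exact Nat.lt_succ_iff.trans WithTop.coe_le_coe.symm

lemma apply_of_step (h : IsFeasible U hU n θ) {i : ℕ} {ω : Ω}
    (hs : numSelections θ (i + 1) ω = numSelections θ i ω + 1) :
    θ (numSelections θ i ω) ω = (i : WithTop ℕ) := by
  have h1 := (h.lt_numSelections_iff (numSelections θ i ω) (i + 1) ω).1 (by omega)
  have h2 := (h.lt_numSelections_iff (numSelections θ i ω) i ω).not.1 (lt_irrefl _)
  rcases eq_top_or_exists_eq_natCast (θ (numSelections θ i ω) ω) with hθ | ⟨a, hθ⟩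
  · rw [hθ] at h1
    exact absurd h1 (by simp)
  · rw [hθ] at h1 h2 ⊢
    norm_cast at h1 h2 ⊢
    omega

/-- Links the reduced state to the actual policy: it is one minus the reflected value of the last
selection, made when the count was `j`. -/
lemma last_selected (h : IsFeasible U hU n θ) {i j : ℕ} {ω : Ω}
    (hN : numSelections θ i ω = j + 1) :
    ∃ a : ℕ, θ j ω = (a : WithTop ℕ) ∧ numSelections θ a ω = j ∧
      redState U (numSelections θ) i ω = 1 - redObs U (numSelections θ) a ω := by
  induction i with
  | zero => rw [h.isCounting.zero] at hN; omega
  | succ i ih =>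
    rcases h.isCounting.step i ω with hs | hs
    · rw [redState, if_pos hs]
      exact ih (by omega)
    · have hj : numSelections θ i ω = j := by omega
      refine ⟨i, ?_, hj, ?_⟩
      · rw [← hj]
        exact h.apply_of_step hs
      · rw [redState, if_neg (by omega)]

lemma admissible (h : IsFeasible U hU n θ) : Admissible U (numSelections θ) := by
  intro i ω hs
  rcases Nat.eq_zero_or_pos (numSelections θ i ω) with h0 | h0
  · exact Or.inl h0
  right
  obtain ⟨j, hj⟩ := Nat.exists_eq_succ_of_ne_zero h0.ne'
  obtain ⟨a, ha, hNa, hst⟩ := h.last_selected hj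
  have hb := h.apply_of_step hs
  rw [hj] at hb
  have halt := h.alternating j ω a i ha hb
  rw [hst, redObs, redObs, hNa, hj]
  by_cases he : Even j
  · have he' : ¬ Even (j + 1) := by simpa [Nat.even_add_one] using he
    rw [if_pos he] at halt
    rw [if_pos he, Nat.succ_eq_add_one, if_neg he']
    linarith
  · have he' : Even (j + 1) := by simpa [Nat.even_add_one] using he
    rw [if_neg he] at halt
    rw [if_neg he, Nat.succ_eq_add_one, if_pos he']
    linarith

end IsFeasible

open Classical in
/-- The selection times, up to the horizon `n`, that belong to the counts `N`. -/
def selectionTime (N : ℕ → Ω → ℕ) (n j : ℕ) (ω : Ω) : WithTop ℕ :=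
  if h : ∃ i, i < n ∧ j < N (i + 1) ω then ((Nat.find h : ℕ) : WithTop ℕ) else ⊤

namespace IsCounting
variable {N : ℕ → Ω → ℕ}

lemma selectionTime_lt_iff (h : IsCounting U N) {n m : ℕ} (hm : m ≤ n) (j : ℕ) (ω : Ω) :
    selectionTime N n j ω < (m : WithTop ℕ) ↔ j < N m ω := by
  classical
  unfold selectionTime
  split_ifs with hex
  · norm_cast
    constructor
    · intro hlt
      exact (Nat.find_spec hex).2.trans_le (h.mono ω hlt)
    · intro hj
      cases m with
      | zero => rw [h.zero] at hj; omega
      | succ m => exact Nat.lt_succ_of_le (Nat.find_min' hex ⟨hm, hj⟩)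
  · simp only [not_top_lt, false_iff]
    intro hj
    cases m with
    | zero => rw [h.zero] at hj; omega
    | succ m => exact hex ⟨m, hm, hj⟩

lemma selectionTime_lt_or_eq_top (N : ℕ → Ω → ℕ) (n j : ℕ) (ω : Ω) :
    selectionTime N n j ω < (n : WithTop ℕ) ∨ selectionTime N n j ω = ⊤ := by
  classical
  unfold selectionTime
  split_ifs with hex
  · left
    exact_mod_cast (Nat.find_spec hex).1
  · exact Or.inr rfl

lemma of_selectionTime_eq (h : IsCounting U N) {n j a : ℕ} {ω : Ω}
    (ha : selectionTime N n j ω = (a : WithTop ℕ)) :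
    a < n ∧ N a ω = j ∧ N (a + 1) ω = j + 1 := by
  have hn : a < n := by
    rcases selectionTime_lt_or_eq_top N n j ω with h1 | h1
    · rw [ha] at h1
      exact_mod_cast h1
    · rw [ha] at h1
      exact absurd h1 (by simp)
  have h1 := (h.selectionTime_lt_iff (show a + 1 ≤ n from hn) j ω).1
    (by rw [ha]; exact_mod_cast a.lt_succ_self)
  have h2 := (h.selectionTime_lt_iff hn.le j ω).not.1 (by rw [ha]; exact lt_irrefl _)
  rcases h.step a ω with hs | hs <;> refine ⟨hn, ?_, ?_⟩ <;> omega

lemma selectionTime_lt_succ (h : IsCounting U N) (n j : ℕ) (ω : Ω)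
    (ht : selectionTime N n j ω ≠ ⊤) : selectionTime N n j ω < selectionTime N n (j + 1) ω := by
  cases hb : selectionTime N n (j + 1) ω with
  | top => exact lt_top_iff_ne_top.2 ht
  | coe b =>
    obtain ⟨hbn, h1, _⟩ := h.of_selectionTime_eq hb
    exact (h.selectionTime_lt_iff hbn.le j ω).2 (by omega)

lemma selectionTime_le_succ (h : IsCounting U N) (n j : ℕ) (ω : Ω) :
    selectionTime N n j ω ≤ selectionTime N n (j + 1) ω := by
  by_cases ht : selectionTime N n j ω = ⊤
  · cases hb : selectionTime N n (j + 1) ω with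
    | top => exact le_top
    | coe b =>
      obtain ⟨hbn, h1, _⟩ := h.of_selectionTime_eq hb
      exact ((h.selectionTime_lt_iff hbn.le j ω).2 (by omega)).le
  · exact (h.selectionTime_lt_succ n j ω ht).le

lemma numSelections_selectionTime (h : IsCounting U N) {n m : ℕ} (hm : m ≤ n) (ω : Ω) :
    numSelections (selectionTime N n) m ω = N m ω := by
  have : {j : ℕ | selectionTime N n j ω < (m : WithTop ℕ)} = Set.Iio (N m ω) := by
    ext j
    exact h.selectionTime_lt_iff hm j ω
  rw [numSelections, this, ← Nat.card_coe_set_eq]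
  simp

lemma isFeasible_selectionTime (h : IsCounting U N) (ha : Admissible U N) [MeasurableSpace Ω]
    (hU : ∀ i, Measurable (U i)) (n : ℕ) : IsFeasible U hU n (selectionTime N n) where
  stopping j i := by
    rw [obsFiltration_eq_past]
    -- Times count from `0`, so `≤ i` means within the first `i + 1` observations; the minimum with
    -- `n` cuts off selections after the horizon.
    have : {ω | selectionTime N n j ω ≤ (i : WithTop ℕ)} = {ω | j < N (min (i + 1) n) ω} := by
      ext ω
      change _ ↔ j < N (min (i + 1) n) ω
      rw [← h.selectionTime_lt_iff (min_le_right _ _)]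
      change selectionTime N n j ω ≤ _ ↔ _
      rcases selectionTime_lt_or_eq_top N n j ω with h1 | h1
      · rcases eq_top_or_exists_eq_natCast (selectionTime N n j ω) with hθ | ⟨a, hθ⟩
        · rw [hθ] at h1
          exact absurd h1 (by simp)
        · rw [hθ] at h1 ⊢
          norm_cast at h1 ⊢
          omega
      · simp [h1]
    refine this ▸ ?_
    exact (h.meas _).mono (past_mono U (min_le_left _ _)) le_rfl (measurableSet_Ioi (a := j))
  horizon j ω := selectionTime_lt_or_eq_top N n j ω
  monotone j ω := h.selectionTime_le_succ n j ω
  strict j ω := h.selectionTime_lt_succ n j ω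
  alternating j ω a b hja hjb := by
    obtain ⟨_, a1, a2⟩ := h.of_selectionTime_eq hja
    obtain ⟨_, b1, b2⟩ := h.of_selectionTime_eq hjb
    have hab : a + 1 ≤ b := by
      by_contra! hlt
      have : N b ω ≤ N a ω := h.mono ω (by omega)
      omega
    have hst : redState U N b ω = 1 - redObs U N a ω := by
      rw [h.redState_eq_of_eq hab (by omega), redState, if_neg (by omega)]
    have hlt := (ha b ω (by omega)).resolve_left (by omega)
    rw [hst, redObs, redObs, a1, b1] at hlt
    by_cases he : Even j
    · have he' : ¬ Even (j + 1) := by simpa [Nat.even_add_one] using he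
      rw [if_pos he, if_neg he'] at hlt
      rw [if_pos he]
      linarith
    · have he' : Even (j + 1) := by simpa [Nat.even_add_one] using he
      rw [if_neg he, if_pos he'] at hlt
      rw [if_neg he]
      linarith

end IsCounting

/-! ### The optimal policy -/

/-- The reflection of the observation `u` after `k` selections. -/
def reflect (k : ℕ) (u : ℝ) : ℝ := if Even k then 1 - u else u

open Classical in
/-- The count and the state of the optimal selection rule for `n` observations. -/
def optPair (U : ℕ → Ω → ℝ) (n : ℕ) : ℕ → Ω → ℕ × ℝ
  | 0, _ => (0, 0)
  | i + 1, ω =>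
    if ((optPair U n i ω).2, reflect (optPair U n i ω).1 (U i ω)) ∈ optRegion (n - 1 - i) ∧
      ((optPair U n i ω).1 = 0 ∨ (optPair U n i ω).2 < reflect (optPair U n i ω).1 (U i ω))
    then ((optPair U n i ω).1 + 1, 1 - reflect (optPair U n i ω).1 (U i ω))
    else optPair U n i ω

/-- The counts of the optimal selection rule. -/
def optN (U : ℕ → Ω → ℝ) (n i : ℕ) (ω : Ω) : ℕ := (optPair U n i ω).1

lemma redObs_optN (U : ℕ → Ω → ℝ) (n i : ℕ) (ω : Ω) :
    redObs U (optN U n) i ω = reflect (optPair U n i ω).1 (U i ω) := rfl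

lemma optPair_snd (U : ℕ → Ω → ℝ) (n i : ℕ) (ω : Ω) :
    (optPair U n i ω).2 = redState U (optN U n) i ω := by
  induction i with
  | zero => rfl
  | succ i ih =>
    rw [redState, ← ih, redObs_optN, optN, optN, optPair]
    split_ifs <;> simp_all

lemma optN_succ (U : ℕ → Ω → ℝ) (n i : ℕ) (ω : Ω) :
    ((redState U (optN U n) i ω, redObs U (optN U n) i ω) ∈ optRegion (n - 1 - i) ∧
      (optN U n i ω = 0 ∨ redState U (optN U n) i ω < redObs U (optN U n) i ω) ∧
      optN U n (i + 1) ω = optN U n i ω + 1) ∨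
    (¬ ((redState U (optN U n) i ω, redObs U (optN U n) i ω) ∈ optRegion (n - 1 - i) ∧
      (optN U n i ω = 0 ∨ redState U (optN U n) i ω < redObs U (optN U n) i ω)) ∧
      optN U n (i + 1) ω = optN U n i ω) := by
  have h : optN U n (i + 1) ω = (optPair U n (i + 1) ω).1 := rfl
  rw [h, ← optPair_snd, redObs_optN, optN, optPair]
  split_ifs with hc
  · exact Or.inl ⟨hc.1, hc.2, rfl⟩
  · exact Or.inr ⟨hc, rfl⟩

lemma measurable_optPair (U : ℕ → Ω → ℝ) (n i : ℕ) : Measurable[past U i] (optPair U n i) := by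
  induction i with
  | zero => exact measurable_const
  | succ i ih =>
    have ih' := ih.mono (past_mono U i.le_succ) le_rfl
    have h1 : Measurable[past U (i + 1)] fun ω => (optPair U n i ω).1 := measurable_fst.comp ih'
    have h2 : Measurable[past U (i + 1)] fun ω => (optPair U n i ω).2 := measurable_snd.comp ih'
    have hu := measurable_past U i.lt_succ_self
    have he : MeasurableSet[past U (i + 1)] {ω | Even (optPair U n i ω).1} :=
      h1 (t := {k : ℕ | Even k}) trivial
    have hx : Measurable[past U (i + 1)] fun ω =>
        reflect (optPair U n i ω).1 (U i ω) :=
      Measurable.ite he (measurable_const.sub hu) hu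
    have hc := ((h2.prodMk hx) (measurableSet_optRegion (n - 1 - i))).inter
      ((h1 (measurableSet_singleton 0)).union (measurableSet_lt h2 hx))
    exact Measurable.ite hc (((measurable_from_top (f := fun k : ℕ => k + 1)).comp h1).prodMk
      (measurable_const.sub hx)) ih'

lemma isCounting_optN (U : ℕ → Ω → ℝ) (n : ℕ) : IsCounting U (optN U n) where
  zero _ := rfl
  step i ω := by
    rcases optN_succ U n i ω with h | h
    · exact Or.inr h.2.2
    · exact Or.inl h.2
  meas i := measurable_fst.comp (measurable_optPair U n i)

/-- The strict inequality is built into the rule so that alternation holds for every outcome, as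
feasibility requires, and not merely almost surely. -/
lemma admissible_optN (U : ℕ → Ω → ℝ) (n : ℕ) : Admissible U (optN U n) := by
  intro i ω hs
  rcases optN_succ U n i ω with h | h
  · exact h.2.1
  · omega

variable [MeasurableSpace Ω] {μ : Measure Ω} [IsProbabilityMeasure μ]

/-- The strict inequality costs nothing: it matters only when the observation equals the state, a
null event. Every loss therefore vanishes almost surely. -/
lemma integral_optN (hU : IsUniformSample μ U) (n : ℕ) :
    ∫ ω, (optN U n n ω : ℝ) ∂μ = valueFn n 0 := by
  have hc := isCounting_optN U n
  have h1 := hc.sum_integral_loss hU n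
  have h2 : ∀ i ∈ Finset.range n, ∫ ω, IsCounting.loss U (optN U n) n i ω ∂μ = 0 := by
    intro i _
    refine integral_eq_zero_of_ae ?_
    have h3 := hc.ae_notMem hU i (E := {p : ℝ × ℝ | p.1 = p.2})
      (isClosed_eq continuous_fst continuous_snd).measurableSet (by
        rintro y x hx x' hx'
        exact (show y = x from hx).symm.trans hx')
    filter_upwards [h3, hc.ae_mem hU] with ω hne hω
    rcases optN_succ U n i ω with h | h
    · have hle := h.1.1
      have hv := h.1.2
      simp only at hle hv
      rw [IsCounting.loss_of_select h.2.2 hle, max_eq_right hv]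
      simp
    · rw [IsCounting.loss_of_skip h.2, Pi.zero_apply, bellman]
      split_ifs with hle
      · have hlt := lt_of_le_of_ne hle hne
        have hv : ¬ valueFn (n - 1 - i) (redState U (optN U n) i ω) ≤
            1 + valueFn (n - 1 - i) (1 - redObs U (optN U n) i ω) :=
          fun hv => h.1 ⟨⟨hle, hv⟩, Or.inr hlt⟩
        rw [max_eq_left (not_le.1 hv).le, sub_self]
      · rw [sub_self]
  rw [Finset.sum_eq_zero h2] at h1
  linarith

theorem isOptimal_selectionTime (hU : IsUniformSample μ U) (n : ℕ) :
    IsOptimal μ U hU.measurable n (selectionTime (optN U n) n) where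
  feasible := (isCounting_optN U n).isFeasible_selectionTime (admissible_optN U n) _ n
  optimal θ' h' := by
    simp only [(isCounting_optN U n).numSelections_selectionTime le_rfl]
    rw [integral_optN hU n]
    exact h'.isCounting.integral_count_le hU h'.admissible n

/-- Comparison with the constructed policy forces the expected count to be `v_n 0`, so the zero-loss
characterization applies to the observations reflected by the parity of the given policy's own
counts. -/
theorem IsOptimal.exists_sample (hU : IsUniformSample μ U) {n : ℕ} {θ : ℕ → Ω → WithTop ℕ}
    (h : IsOptimal μ U hU.measurable n θ) :
    ∃ X : ℕ → Ω → ℝ, IsUniformSample μ X ∧ (∀ i ω, X i ω = U i ω ∨ X i ω = 1 - U i ω) ∧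
      ∀ᵐ ω ∂μ, ∀ m ≤ n, numSelections θ m ω = optimalCount n (fun i => X i ω) m := by
  have hc := h.feasible.isCounting
  have ha := h.feasible.admissible
  refine ⟨redObs U (numSelections θ), hc.isUniformSample_redObs hU, fun i ω => ?_,
    hc.ae_count_eq hU ha (le_antisymm (hc.integral_count_le hU ha n) ?_)⟩
  · unfold redObs
    split_ifs
    · exact Or.inr rfl
    · exact Or.inl rfl
  · have := h.optimal _ (isOptimal_selectionTime hU n).feasible
    simp only [(isCounting_optN U n).numSelections_selectionTime le_rfl] at this
    rwa [integral_optN hU n] at this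

end Policy

end AltSelection

end

theorem mainTheorem3 :
    -- the minimal fixed points converge, so that `xiLimit` is their limit
    Tendsto AltSelection.minFixedPoint atTop (𝓝 AltSelection.xiLimit) ∧
    -- `optimalCount` represents the number of selections made by the optimal policy
    (∀ (Ω : Type*) [MeasurableSpace Ω] (μ : Measure Ω) [IsProbabilityMeasure μ] (U : ℕ → Ω → ℝ)
        (hU : AltSelection.IsUniformSample μ U) (n : ℕ),
      (∃ θ : ℕ → Ω → WithTop ℕ, AltSelection.IsOptimal μ U hU.measurable n θ) ∧
      ∀ θ : ℕ → Ω → WithTop ℕ, AltSelection.IsOptimal μ U hU.measurable n θ →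
        ∃ X : ℕ → Ω → ℝ, AltSelection.IsUniformSample μ X ∧
          (∀ i ω, X i ω = U i ω ∨ X i ω = 1 - U i ω) ∧
          ∀ᵐ ω ∂μ, ∀ m ≤ n, AltSelection.numSelections θ m ω =
            AltSelection.optimalCount n (fun i => X i ω) m) ∧
    -- the `L²` estimate
    ∃ C : ℝ, ∀ (Ω : Type*) [MeasurableSpace Ω] (μ : Measure Ω) [IsProbabilityMeasure μ]
        (X : ℕ → Ω → ℝ), AltSelection.IsUniformSample μ X →
      (∀ n : ℕ, 3 ≤ n →
        MemLp (AltSelection.centeredDiff μ X n) 2 μ ∧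
        lpNorm (AltSelection.centeredDiff μ X n) 2 μ ^ 2 ≤
          C * ∑ k ∈ Finset.Icc 3 n, (AltSelection.xiLimit - AltSelection.minFixedPoint k)) ∧
      (fun n : ℕ => lpNorm (AltSelection.centeredDiff μ X n) 2 μ) =o[atTop]
        fun n : ℕ => Real.sqrt n := by
  refine ⟨AltSelection.tendsto_minFixedPoint, fun Ω _ μ _ U hU n =>
    ⟨⟨_, AltSelection.isOptimal_selectionTime hU n⟩, fun θ hθ => hθ.exists_sample hU⟩,
    AltSelection.l2Const, fun Ω _ μ _ X hX => ⟨fun n hn => AltSelection.memLp_centeredDiff hX hn,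
      AltSelection.isLittleO_lpNorm_centeredDiff hX⟩⟩
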